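/- All spaces are over $\mathbb R$. A quasinorm on a vector space $X$ is a map $\|\cdot\|:X\to[0,\infty)$ with $\|x\|=0$ iff $x=0$, $\|tx\|=|t|\|x\|$, and $\|x+y\|\le\Delta(\|x\|+\|y\|)$ for some constant $\Delta$; a quasi-Banach space is a complete quasinormed space. A map $f:X\to Y$ between quasinormed spaces is bounded if $\|f(x)\|\le M\|x\|$ for some $M$ and all $x$; operators are bounded linear maps. For a homogeneous map $g$ put $\|g\|=\sup_{\|x\|=1}\|g(x)\|\in[0,\infty]$. Quasilinear maps. A map $f:X\to Y$ is quasilinear if $f(tx)=tf(x)$ for all $t\in\mathbb R$, $x\in X$, and there is a constant $Q$ with $\|f(x+y)-f(x)-f(y)\|\le Q(\|x\|+\|y\|)$ for all $x,y\in X$; the least such $Q$ is denoted $Q[f]$. It is trivial if there is a (possibly unbounded) linear map $\ell:X\to Y$ with $\|f-\ell\|<\infty$. $K[X,Y]\in[0,\infty]$ is the infimum of the constants $C\ge 0$ such that for every quasilinear $f:X\to Y$ there is a linear $\ell:X\to Y$ with $\|f-\ell\|\le C\,Q[f]$; $K_0[X,Y]$ is defined in the same way using only the bounded quasilinear maps $f$.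 $X$ is a $\mathcal K$-space if $K[X,\mathbb R]<\infty$. Ultrapowers. An ultrafilter is countably incomplete if it contains countably many sets with empty intersection. If $\mathscr U$ is a countably incomplete ultrafilter on a set $I$ and $X$ is a quasinormed space, the ultrapower $X_{\mathscr U}$ is the space of families $(x_i)\in X^I$ with $\lim_{\mathscr U(i)}\|x_i\|<\infty$ modulo those with $\lim_{\mathscr U(i)}\|x_i\|=0$. The class of $(x_i)$ is denoted $(x_i)_{\mathscr U}$, and its quasinorm is $\lim_{\mathscr U(i)}\|x_i\|$ (if the quasinorm of $X$ is not continuous, the infimum of these limits over all families representing the class). A map $F:X_{\mathscr U}\to Y_{\mathscr U}$ is induced by a family of maps $f_i:X\to Y$ $(i\in I)$ if $F((x_i)_{\mathscr U})=(f_i(x_i))_{\mathscr U}$ for every $(x_i)_{\mathscr U}\in X_{\mathscr U}$. It is accessible if it is induced by some family of (arbitrary) maps $f_i:X\to Y$, and it is an ultraproduct of operators if it is induced by a family of operators $X\to Y$. A quasi-Banach space $Y$ is an ultrasummand if for each of its ultrapowers $Y_{\mathscr V}$ there is an operator $P:Y_{\mathscr V}\to Y$ with $P((y)_{\mathscr V})=y$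 for all $y\in Y$, where $(y)_{\mathscr V}$ is the class of the constant family. A quasi-Banach space $X$ has the bounded approximation property (BAP) if there is $\lambda\ge1$ such that for every finite-dimensional subspace $E\subset X$ and every $\varepsilon>0$ there is a finite-rank operator $t:X\to X$ with $\|t(x)\|\le\lambda\|x\|$ for all $x\in X$ and $\|t(x)-x\|\le\varepsilon\|x\|$ for all $x\in E$. Statement. Let $\mathscr U$ be a countably incomplete ultrafilter on a set $I$, and let $X$ and $Y$ be quasi-Banach spaces with $Y$ an ultrasummand. Suppose that either $X$ has the BAP, or $X$ is a $\mathcal K$-space and $Y$ has the BAP. Then the following statements are equivalent: 1. Every accessible operator $X_{\mathscr U}\to Y_{\mathscr U}$ is an ultraproduct of operators. 2. $K[X,Y]<\infty$. 3. $K_0[X,Y]<\infty$. 4. Every quasilinear map $X\to Y$ is trivial. 5. Every short exact sequence $0\to Y\xrightarrow{\,j\,} Z\xrightarrow{\,q\,} X\to0$ of quasi-Banach spaces and operators splits, that is, there is an operator $r:Z\to Y$ with $r\circ j=\mathbf 1_Y$. -/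

import Mathlib

open Filter Topology
open scoped ENNReal

universe u v w

/-- The function `‖·‖` is a quasinorm on the real vector space `X`. -/
class IsQuasinormed (X : Type u) [AddCommGroup X] [Module ℝ X] [Norm X] : Prop where
  nonneg : ∀ x : X, 0 ≤ ‖x‖
  eq_zero_iff : ∀ x : X, ‖x‖ = 0 ↔ x = 0
  smul : ∀ (t : ℝ) (x : X), ‖t • x‖ = |t| * ‖x‖
  add_le : ∃ Δ : ℝ, ∀ x y : X, ‖x + y‖ ≤ Δ * (‖x‖ + ‖y‖)

/-- Quasi-Banach spaces: complete quasinormed spaces. The balls of radius `1/n` are a countable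
neighbourhood base at zero, so completeness is completeness for Cauchy sequences. -/
class IsQuasiBanach (X : Type u) [AddCommGroup X] [Module ℝ X] [Norm X] : Prop
    extends IsQuasinormed X where
  complete : ∀ s : ℕ → X,
    (∀ ε : ℝ, 0 < ε → ∃ N, ∀ m n, N ≤ m → N ≤ n → ‖s m - s n‖ < ε) →
      ∃ x : X, Tendsto (fun n => ‖s n - x‖) atTop (𝓝 0)

section Maps

variable {X : Type u} {Y : Type v} [AddCommGroup X] [Module ℝ X] [Norm X]
  [AddCommGroup Y] [Module ℝ Y] [Norm Y]

/-- A (not necessarily linear) map is bounded if `‖f x‖ ≤ M ‖x‖` for some constant `M`.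
Operators are the bounded linear maps. -/
def IsBoundedMap (f : X → Y) : Prop := ∃ M : ℝ, ∀ x, ‖f x‖ ≤ M * ‖x‖

def IsHomogeneous (f : X → Y) : Prop := ∀ (t : ℝ) (x : X), f (t • x) = t • f x

/-- `‖f‖ = sup {‖f x‖ : ‖x‖ = 1}`, possibly infinite. -/
noncomputable def homNorm (f : X → Y) : ℝ≥0∞ := ⨆ (x : X) (_ : ‖x‖ = 1), ENNReal.ofReal ‖f x‖

def IsQuasilinear (f : X → Y) : Prop :=
  IsHomogeneous f ∧ ∃ Q : ℝ, ∀ x y, ‖f (x + y) - f x - f y‖ ≤ Q * (‖x‖ + ‖y‖)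

/-- The quasilinearity constant `Q[f]`. -/
noncomputable def quasilinConst (f : X → Y) : ℝ≥0∞ :=
  sInf {Q : ℝ≥0∞ | ∀ x y,
    ENNReal.ofReal ‖f (x + y) - f x - f y‖ ≤ Q * ENNReal.ofReal (‖x‖ + ‖y‖)}

/-- `f` is trivial if it is at finite distance from some (possibly unbounded) linear map. -/
def IsTrivialMap (f : X → Y) : Prop := ∃ l : X →ₗ[ℝ] Y, homNorm (fun x => f x - l x) < ⊤

variable (X Y)

/-- The approximation constant `K[X, Y]`. -/
noncomputable def approxK : ℝ≥0∞ :=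
  sInf {C : ℝ≥0∞ | ∀ f : X → Y, IsQuasilinear f →
    ∃ l : X →ₗ[ℝ] Y, homNorm (fun x => f x - l x) ≤ C * quasilinConst f}

/-- The approximation constant `K₀[X, Y]`. -/
noncomputable def approxK₀ : ℝ≥0∞ :=
  sInf {C : ℝ≥0∞ | ∀ f : X → Y, IsQuasilinear f → IsBoundedMap f →
    ∃ l : X →ₗ[ℝ] Y, homNorm (fun x => f x - l x) ≤ C * quasilinConst f}

/-- `X` is a `𝒦`-space. -/
def IsKSpace : Prop := approxK X ℝ < ⊤

/-- The bounded approximation property. -/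
def HasBAP : Prop :=
  ∃ c : ℝ, 1 ≤ c ∧ ∀ E : Submodule ℝ X, FiniteDimensional ℝ E → ∀ ε : ℝ, 0 < ε →
    ∃ t : X →ₗ[ℝ] X, FiniteDimensional ℝ (LinearMap.range t) ∧
      (∀ x, ‖t x‖ ≤ c * ‖x‖) ∧ ∀ x ∈ E, ‖t x - x‖ ≤ ε * ‖x‖

/-- Every short exact sequence `0 → Y → Z → X → 0` of quasi-Banach spaces and operators splits.
(Every such `Z` is in bijection with `Y × X`, so no generality is lost in the universe of `Z`.) -/
def EveryExtensionSplits : Prop :=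
  ∀ (Z : Type (max u v)) [AddCommGroup Z] [Module ℝ Z] [Norm Z] [IsQuasiBanach Z]
    (j : Y →ₗ[ℝ] Z) (q : Z →ₗ[ℝ] X), IsBoundedMap j → IsBoundedMap q →
    Function.Injective j → LinearMap.range j = LinearMap.ker q → Function.Surjective q →
    ∃ r : Z →ₗ[ℝ] Y, IsBoundedMap r ∧ r ∘ₗ j = LinearMap.id

end Maps

section Ultrapowers

variable {I : Type w}

def CountablyIncomplete (U : Ultrafilter I) : Prop :=
  ∃ S : ℕ → Set I, (∀ n, S n ∈ U) ∧ ⋂ n, S n = ∅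

variable (U : Ultrafilter I) (X : Type u) [AddCommGroup X] [Module ℝ X] [Norm X]
  [IsQuasinormed X]

/-- The families `(x_i)` that are finite with respect to `U`, that is `lim_U ‖x_i‖ < ∞`. -/
def finiteFamilies : Submodule ℝ (I → X) where
  carrier := {x | ∃ M : ℝ, ∀ᶠ i in (U : Filter I), ‖x i‖ ≤ M}
  zero_mem' := ⟨0, Eventually.of_forall fun _ =>
    ((IsQuasinormed.eq_zero_iff (0 : X)).2 rfl).le⟩
  add_mem' := by
    rintro x y ⟨M, hM⟩ ⟨N, hN⟩
    obtain ⟨Δ, hΔ⟩ := IsQuasinormed.add_le (X := X)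
    refine ⟨|Δ| * (M + N), ?_⟩
    filter_upwards [hM, hN] with i h1 h2
    have h3 := IsQuasinormed.nonneg (x i)
    have h4 := IsQuasinormed.nonneg (y i)
    calc ‖x i + y i‖ ≤ Δ * (‖x i‖ + ‖y i‖) := hΔ _ _
      _ ≤ |Δ| * (‖x i‖ + ‖y i‖) := mul_le_mul_of_nonneg_right (le_abs_self _) (by linarith)
      _ ≤ |Δ| * (M + N) := mul_le_mul_of_nonneg_left (by linarith) (abs_nonneg _)
  smul_mem' := by
    rintro c x ⟨M, hM⟩
    refine ⟨|c| * M, ?_⟩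
    filter_upwards [hM] with i h1
    have h2 := IsQuasinormed.smul c (x i)
    simpa [h2] using mul_le_mul_of_nonneg_left h1 (abs_nonneg c)

/-- The families `(x_i)` that are infinitesimal with respect to `U`, that is
`lim_U ‖x_i‖ = 0`. -/
def infinitesimalFamilies : Submodule ℝ (I → X) where
  carrier := {x | Tendsto (fun i => ‖x i‖) (U : Filter I) (𝓝 0)}
  zero_mem' := by
    have h : ‖(0 : X)‖ = 0 := (IsQuasinormed.eq_zero_iff (0 : X)).2 rfl
    simp [h]
  add_mem' := by
    intro x y hx hy
    obtain ⟨Δ, hΔ⟩ := IsQuasinormed.add_le (X := X)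
    have h : Tendsto (fun i => Δ * (‖x i‖ + ‖y i‖)) (U : Filter I) (𝓝 0) := by
      simpa using (Tendsto.add hx hy).const_mul Δ
    exact squeeze_zero (fun i => IsQuasinormed.nonneg _) (fun i => hΔ _ _) h
  smul_mem' := by
    intro c x hx
    have h : Tendsto (fun i => |c| * ‖x i‖) (U : Filter I) (𝓝 0) := by
      simpa using Tendsto.const_mul |c| hx
    refine h.congr fun i => ?_
    exact (IsQuasinormed.smul c (x i)).symm

/-- The ultrapower `X_U`: finite families modulo infinitesimal ones. -/
def Ultrapower : Type (max u w) :=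
  finiteFamilies U X ⧸ (infinitesimalFamilies U X).submoduleOf (finiteFamilies U X)

instance : AddCommGroup (Ultrapower U X) :=
  inferInstanceAs (AddCommGroup
    (finiteFamilies U X ⧸ (infinitesimalFamilies U X).submoduleOf (finiteFamilies U X)))

instance : Module ℝ (Ultrapower U X) :=
  inferInstanceAs (Module ℝ
    (finiteFamilies U X ⧸ (infinitesimalFamilies U X).submoduleOf (finiteFamilies U X)))

/-- The class `(x_i)_U` of a finite family, as a linear map. -/
def Ultrapower.mk : finiteFamilies U X →ₗ[ℝ] Ultrapower U X :=
  ((infinitesimalFamilies U X).submoduleOf (finiteFamilies U X)).mkQ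

/-- The quasinorm of the ultrapower, `‖(x_i)_U‖ = lim_U ‖x_i‖`. When the quasinorm of `X` is
continuous (for instance a `p`-norm) this limit does not depend on the representative; in
general one takes the infimum over the representatives, which is the quotient quasinorm. -/
noncomputable instance : Norm (Ultrapower U X) where
  norm z := sInf {r : ℝ | ∃ x : finiteFamilies U X,
    Ultrapower.mk U X x = z ∧ Tendsto (fun i => ‖x.1 i‖) (U : Filter I) (𝓝 r)}

/-- The diagonal embedding `X → X_U`. -/
def Ultrapower.diag : X →ₗ[ℝ] Ultrapower U X :=
  Ultrapower.mk U X ∘ₗ LinearMap.codRestrict (finiteFamilies U X)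
    (LinearMap.pi fun _ : I => (LinearMap.id : X →ₗ[ℝ] X))
    (fun x => ⟨‖x‖, Eventually.of_forall fun _ => le_rfl⟩)

/-- `X` is an ultrasummand: it is complemented in all its ultrapowers through the diagonal
embedding (ultrapowers are taken with respect to countably incomplete ultrafilters). -/
def IsUltrasummand : Prop :=
  ∀ (J : Type u) (V : Ultrafilter J), CountablyIncomplete V →
    ∃ P : Ultrapower V X →ₗ[ℝ] X, IsBoundedMap P ∧ P ∘ₗ Ultrapower.diag V X = LinearMap.id

variable {U X} {Y : Type v} [AddCommGroup Y] [Module ℝ Y] [Norm Y] [IsQuasinormed Y]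

/-- `F = (f_i)_U`: for every finite family `(x_i)` the family `(f_i(x_i))` is finite and
`F((x_i)_U) = (f_i(x_i))_U`. -/
def IsInducedBy (F : Ultrapower U X → Ultrapower U Y) (f : I → X → Y) : Prop :=
  ∀ x : finiteFamilies U X, ∃ h : (fun i => f i (x.1 i)) ∈ finiteFamilies U Y,
    F (Ultrapower.mk U X x) = Ultrapower.mk U Y ⟨fun i => f i (x.1 i), h⟩

/-- Accessible maps: those induced by an (admissible) family of arbitrary maps. -/
def IsAccessible (F : Ultrapower U X → Ultrapower U Y) : Prop :=
  ∃ f : I → X → Y, IsInducedBy F f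

/-- `F` is an ultraproduct of operators `X → Y`. -/
def IsUltraproductOfOperators (F : Ultrapower U X → Ultrapower U Y) : Prop :=
  ∃ t : I → X →ₗ[ℝ] Y, (∀ i, IsBoundedMap (t i)) ∧ IsInducedBy F (fun i => t i)

end Ultrapowers

/-!
A quasilinear map `f : X → Y` and an extension of `X` by `Y` are two views of one object: `f` yields
the twisted sum `Y × X` quasinormed by `‖y - f x‖ + ‖x‖`, and in an extension the difference of a
bounded homogeneous section and a linear section of the quotient map is quasilinear. A bounded
retraction onto `Y` corresponds to a linear map at finite distance from `f`.

If quasilinear maps are trivial without a uniform constant, a gliding hump over subseries of a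
geometrically small sum of bad maps contradicts Baire's theorem. It suffices to be bad on finite
sets, because a linear approximation on every finite-dimensional subspace becomes a global one in an
ultrapower of `Y`, which is brought back to `Y` by the projection of the ultrasummand. The
approximation property replaces a map, on a finite set, by a bounded one: compose with finite-rank
operators on `X`, or, once the coordinates of `f` are corrected by linear functionals, on `Y`.

An accessible operator is induced by homogeneous maps whose additivity defects tend to zero along
the ultrafilter, so `K₀[X, Y] < ∞` moves these maps to operators without changing the class. If
`K₀[X, Y] = ∞`, bounded maps with infinitesimal defect that stay away from the linear maps induce an
accessible operator that is not an ultraproduct of operators.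
-/

open IsQuasinormed

namespace IsQuasinormed

section Basic

variable (X : Type u) [AddCommGroup X] [Module ℝ X] [Norm X] [IsQuasinormed X]

/-- A modulus of concavity of the quasinorm: a constant, normalized to be at least one, that is
admissible in the quasi-triangle inequality. -/
noncomputable def modulus : ℝ := max 1 (add_le (X := X)).choose

theorem one_le_modulus : 1 ≤ modulus X := le_max_left _ _

theorem modulus_pos : 0 < modulus X := zero_lt_one.trans_le (one_le_modulus X)

theorem modulus_nonneg : 0 ≤ modulus X := (modulus_pos X).le

/-- The ratio `1 / (2 Δ)`, where `Δ` is the modulus of concavity: series dominated by a geometric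
series of this ratio converge in quasi-Banach spaces. -/
noncomputable def ratio : ℝ := (2 * modulus X)⁻¹

theorem ratio_pos : 0 < ratio X := inv_pos.2 (mul_pos two_pos (modulus_pos X))

theorem modulus_mul_ratio : modulus X * ratio X = 1 / 2 := by
  have := (modulus_pos X).ne'
  rw [ratio]
  field_simp

theorem ratio_le_half : ratio X ≤ 1 / 2 := by
  rw [← modulus_mul_ratio X]
  exact le_mul_of_one_le_left (ratio_pos X).le (one_le_modulus X)

theorem tendsto_const_mul_ratio_pow (M : ℝ) :
    Tendsto (fun n : ℕ => M * ratio X ^ n) atTop (𝓝 0) := by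
  have h : ratio X < 1 := (ratio_le_half X).trans_lt one_half_lt_one
  simpa using (tendsto_pow_atTop_nhds_zero_of_lt_one (ratio_pos X).le h).const_mul M

variable {X}

protected theorem norm_add_le (x y : X) : ‖x + y‖ ≤ modulus X * (‖x‖ + ‖y‖) :=
  ((add_le (X := X)).choose_spec x y).trans <|
    mul_le_mul_of_nonneg_right (le_max_right _ _) (add_nonneg (nonneg x) (nonneg y))

@[simp]
protected theorem norm_zero : ‖(0 : X)‖ = 0 := (eq_zero_iff (0 : X)).2 rfl

@[simp]
protected theorem norm_neg (x : X) : ‖-x‖ = ‖x‖ := by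
  simpa using smul (-1) x

protected theorem norm_sub_rev (x y : X) : ‖x - y‖ = ‖y - x‖ := by
  rw [← IsQuasinormed.norm_neg (x - y), neg_sub]

protected theorem norm_sub_le (x y : X) : ‖x - y‖ ≤ modulus X * (‖x‖ + ‖y‖) := by
  simpa [sub_eq_add_neg] using IsQuasinormed.norm_add_le x (-y)

protected theorem norm_sub_le_norm_sub_add_norm_sub (x y z : X) :
    ‖x - z‖ ≤ modulus X * (‖x - y‖ + ‖y - z‖) := by
  simpa using IsQuasinormed.norm_add_le (x - y) (y - z)

protected theorem norm_le_norm_add_norm_sub (x y : X) :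
    ‖x‖ ≤ modulus X * (‖y‖ + ‖x - y‖) := by
  simpa using IsQuasinormed.norm_add_le y (x - y)

protected theorem norm_pos {x : X} (hx : x ≠ 0) : 0 < ‖x‖ :=
  (nonneg x).lt_of_ne fun h => hx ((eq_zero_iff x).1 h.symm)

theorem eq_zero_of_norm_nonpos {x : X} (hx : ‖x‖ ≤ 0) : x = 0 :=
  (eq_zero_iff x).1 (hx.antisymm (nonneg x))

theorem norm_inv_norm_smul {x : X} (hx : x ≠ 0) : ‖(‖x‖⁻¹ • x)‖ = 1 := by
  have h := IsQuasinormed.norm_pos hx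
  rw [smul, abs_of_pos (inv_pos.2 h), inv_mul_cancel₀ h.ne']

end Basic

instance : IsQuasinormed ℝ where
  nonneg := norm_nonneg
  eq_zero_iff _ := norm_eq_zero
  smul t x := by simp
  add_le := ⟨1, fun x y => by simpa using abs_add_le x y⟩

section Sums

variable {X : Type u} [AddCommGroup X] [Module ℝ X] [Norm X] [IsQuasinormed X]

theorem norm_sum_range_le (n : ℕ) (x : ℕ → X) :
    ‖∑ k ∈ Finset.range n, x k‖ ≤ ∑ k ∈ Finset.range n, modulus X ^ (k + 1) * ‖x k‖ := by
  induction n generalizing x with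
  | zero => simp
  | succ n ih =>
    calc ‖∑ k ∈ Finset.range (n + 1), x k‖
        ≤ modulus X * (‖∑ k ∈ Finset.range n, x (k + 1)‖ + ‖x 0‖) := by
          rw [Finset.sum_range_succ']
          exact IsQuasinormed.norm_add_le _ _
      _ ≤ modulus X * (∑ k ∈ Finset.range n, modulus X ^ (k + 1) * ‖x (k + 1)‖ + ‖x 0‖) :=
          mul_le_mul_of_nonneg_left (by gcongr; exact ih _) (modulus_nonneg X)
      _ = ∑ k ∈ Finset.range (n + 1), modulus X ^ (k + 1) * ‖x k‖ := by
          rw [Finset.sum_range_succ', mul_add, Finset.mul_sum]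
          simp only [pow_succ' (modulus X) (_ + 1), mul_assoc, zero_add, pow_one]

theorem norm_sum_range_le_of_geometric (n : ℕ) {x : ℕ → X} {M : ℝ}
    (hx : ∀ k, ‖x k‖ ≤ M * ratio X ^ k) :
    ‖∑ k ∈ Finset.range n, x k‖ ≤ 2 * modulus X * M := by
  have hM : 0 ≤ M := (nonneg _).trans (by simpa using hx 0)
  have hterm (k : ℕ) : modulus X ^ (k + 1) * ‖x k‖ ≤ modulus X * M * (1 / 2) ^ k :=
    calc modulus X ^ (k + 1) * ‖x k‖ ≤ modulus X ^ (k + 1) * (M * ratio X ^ k) :=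
          mul_le_mul_of_nonneg_left (hx k) (pow_nonneg (modulus_nonneg X) _)
      _ = modulus X * M * (1 / 2) ^ k := by rw [← modulus_mul_ratio X]; ring
  calc ‖∑ k ∈ Finset.range n, x k‖
      ≤ ∑ k ∈ Finset.range n, modulus X * M * (1 / 2) ^ k :=
        (norm_sum_range_le n x).trans (Finset.sum_le_sum fun k _ => hterm k)
    _ ≤ modulus X * M * 2 := by
        rw [← Finset.mul_sum]
        exact mul_le_mul_of_nonneg_left (sum_geometric_two_le n)
          (mul_nonneg (modulus_nonneg X) hM)
    _ = 2 * modulus X * M := by ring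

theorem norm_sum_range_sub_sum_range_le_of_geometric {m n : ℕ} (hmn : m ≤ n) {x : ℕ → X}
    {M : ℝ} (hx : ∀ k, ‖x k‖ ≤ M * ratio X ^ k) :
    ‖∑ k ∈ Finset.range n, x k - ∑ k ∈ Finset.range m, x k‖
      ≤ 2 * modulus X * M * ratio X ^ m := by
  rw [← Finset.sum_Ico_eq_sub _ hmn, Finset.sum_Ico_eq_sum_range, mul_assoc]
  refine norm_sum_range_le_of_geometric _ fun k => (hx _).trans_eq ?_
  rw [pow_add, mul_assoc]

end Sums

end IsQuasinormed

section Convergence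

variable {X : Type u} [AddCommGroup X] [Module ℝ X] [Norm X]

/-- Convergence of a sequence for the quasinorm. -/
def QTendsto (s : ℕ → X) (x : X) : Prop := Tendsto (fun n => ‖s n - x‖) atTop (𝓝 0)

/-- Cauchy sequences for the quasinorm. -/
def QCauchy (s : ℕ → X) : Prop :=
  Tendsto (fun p : ℕ × ℕ => ‖s p.1 - s p.2‖) atTop (𝓝 0)

theorem QTendsto.map {Y : Type v} [AddCommGroup Y] [Module ℝ Y] [Norm Y] [IsQuasinormed Y]
    {s : ℕ → X} {x : X} (hs : QTendsto s x) (f : X →ₗ[ℝ] Y) (hf : IsBoundedMap f) :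
    QTendsto (fun n => f (s n)) (f x) := by
  obtain ⟨M, hM⟩ := hf
  refine squeeze_zero (fun _ => nonneg _) (fun n => ?_) (by simpa using Tendsto.const_mul M hs)
  simpa using hM (s n - x)

theorem QCauchy.map {Y : Type v} [AddCommGroup Y] [Module ℝ Y] [Norm Y] [IsQuasinormed Y]
    {s : ℕ → X} (hs : QCauchy s) (f : X →ₗ[ℝ] Y) (hf : IsBoundedMap f) :
    QCauchy fun n => f (s n) := by
  obtain ⟨M, hM⟩ := hf
  refine squeeze_zero (fun _ => nonneg _) (fun p => ?_) (by simpa using Tendsto.const_mul M hs)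
  simpa using hM (s p.1 - s p.2)

variable [IsQuasinormed X]

namespace QTendsto

variable {s t : ℕ → X} {x y : X}

theorem const (x : X) : QTendsto (fun _ => x) x := by
  simp [QTendsto]

theorem smul (hs : QTendsto s x) (c : ℝ) : QTendsto (fun n => c • s n) (c • x) := by
  simpa [QTendsto, ← smul_sub, IsQuasinormed.smul] using Tendsto.const_mul |c| hs

theorem sub (hs : QTendsto s x) (ht : QTendsto t y) :
    QTendsto (fun n => s n - t n) (x - y) := by
  refine squeeze_zero (fun _ => nonneg _) (fun n => ?_)
    (by simpa using (Tendsto.add hs ht).const_mul (modulus X))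
  simpa [sub_sub_sub_comm] using IsQuasinormed.norm_sub_le (s n - x) (t n - y)

theorem add (hs : QTendsto s x) (ht : QTendsto t y) :
    QTendsto (fun n => s n + t n) (x + y) := by
  simpa [sub_eq_add_neg] using hs.sub (ht.smul (-1))

theorem norm_le (hs : QTendsto s x) {M : ℝ} (hM : ∀ᶠ n in atTop, ‖s n‖ ≤ M) :
    ‖x‖ ≤ modulus X * M := by
  have hlim : Tendsto (fun n => modulus X * (M + ‖x - s n‖)) atTop (𝓝 (modulus X * M)) := by
    simpa [IsQuasinormed.norm_sub_rev x] using (Tendsto.const_add M hs).const_mul (modulus X)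
  refine ge_of_tendsto hlim (hM.mono fun n hn => ?_)
  exact (IsQuasinormed.norm_le_norm_add_norm_sub x (s n)).trans
    (mul_le_mul_of_nonneg_left (by gcongr) (modulus_nonneg X))

theorem unique (hx : QTendsto s x) (hy : QTendsto s y) : x = y := by
  have h : ‖x - y‖ ≤ modulus X * 0 :=
    (hx.sub hy).norm_le (Eventually.of_forall fun n => by simp)
  exact sub_eq_zero.1 (eq_zero_of_norm_nonpos (by simpa using h))

end QTendsto

namespace QCauchy

theorem iff_forall_exists {s : ℕ → X} :
    QCauchy s ↔ ∀ ε : ℝ, 0 < ε → ∃ N, ∀ m n, N ≤ m → N ≤ n → ‖s m - s n‖ < ε := by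
  have h : QCauchy s ↔ ∀ ε : ℝ, 0 < ε → ∀ᶠ p : ℕ × ℕ in atTop, ‖s p.1 - s p.2‖ < ε := by
    simp [QCauchy, Metric.tendsto_nhds, abs_of_nonneg (nonneg _)]
  simp only [h, eventually_atTop_prod_self]

theorem of_le {s : ℕ → X} {b : ℕ → ℝ} (hb : Tendsto b atTop (𝓝 0))
    (h : ∀ m n, m ≤ n → ‖s n - s m‖ ≤ b m) : QCauchy s := by
  refine iff_forall_exists.2 fun ε hε => ?_
  obtain ⟨N, hN⟩ := (hb.eventually_lt_const hε).exists_forall_of_atTop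
  refine ⟨N, fun m n hm hn => ?_⟩
  rcases le_total n m with hnm | hmn
  · exact (h n m hnm).trans_lt (hN n hn)
  · rw [IsQuasinormed.norm_sub_rev]
    exact (h m n hmn).trans_lt (hN m hm)

theorem sub {s t : ℕ → X} (hs : QCauchy s) (ht : QCauchy t) : QCauchy fun n => s n - t n := by
  refine squeeze_zero (fun _ => nonneg _) (fun p => ?_)
    (by simpa using (Tendsto.add hs ht).const_mul (modulus X))
  simpa [sub_sub_sub_comm] using IsQuasinormed.norm_sub_le (s p.1 - s p.2) (t p.1 - t p.2)

end QCauchy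

theorem QTendsto.qCauchy {s : ℕ → X} {x : X} (hs : QTendsto s x) : QCauchy s := by
  refine squeeze_zero (fun _ => nonneg _)
    (fun p => IsQuasinormed.norm_sub_le_norm_sub_add_norm_sub (s p.1) x (s p.2)) ?_
  have h := (Tendsto.add (hs.comp tendsto_fst) (hs.comp tendsto_snd)).const_mul (modulus X)
  simpa [prod_atTop_atTop_eq, Function.comp_def, IsQuasinormed.norm_sub_rev x] using h

end Convergence

namespace IsQuasiBanach

variable {X : Type u} [AddCommGroup X] [Module ℝ X] [Norm X] [IsQuasiBanach X]

theorem exists_qTendsto {s : ℕ → X} (hs : QCauchy s) : ∃ x, QTendsto s x :=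
  complete s (QCauchy.iff_forall_exists.1 hs)

theorem exists_qTendsto_sum {x : ℕ → X} {M : ℝ} (hx : ∀ k, ‖x k‖ ≤ M * ratio X ^ k) :
    ∃ s : X, QTendsto (fun n => ∑ k ∈ Finset.range n, x k) s ∧
      ∀ m, ‖s - ∑ k ∈ Finset.range m, x k‖ ≤ modulus X * (2 * modulus X * M * ratio X ^ m) := by
  obtain ⟨s, hs⟩ := exists_qTendsto (QCauchy.of_le (tendsto_const_mul_ratio_pow X _)
    fun m n hmn => norm_sum_range_sub_sum_range_le_of_geometric hmn hx)
  refine ⟨s, hs, fun m => (hs.sub (.const _)).norm_le ?_⟩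
  filter_upwards [eventually_ge_atTop m] with n hmn
  exact norm_sum_range_sub_sum_range_le_of_geometric hmn hx

end IsQuasiBanach

section GlidingHump

/-- Baire's theorem in the Cantor space: some `A N` is dense in a cylinder. -/
theorem exists_pair_differing_at_of_iUnion_eq_univ {A : ℕ → Set (Set ℕ)}
    (hA : ⋃ N, A N = Set.univ) :
    ∃ N n₀ : ℕ, ∀ n, n₀ ≤ n → ∀ m, ∃ S ∈ A N, ∃ S' ∈ A N, n ∈ S ∧ n ∉ S' ∧
      ∀ k, k < m → k ≠ n → (k ∈ S ↔ k ∈ S') := by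
  let B (N : ℕ) : Set (ℕ → Bool) := {c | {k | c k = true} ∈ A N}
  have hcover : ⋃ N, closure (B N) = Set.univ := by
    refine Set.eq_univ_of_forall fun c => ?_
    obtain ⟨N, hN⟩ := Set.mem_iUnion.1 (hA.symm ▸ Set.mem_univ {k | c k = true})
    exact Set.mem_iUnion.2 ⟨N, subset_closure hN⟩
  obtain ⟨N, a, ha⟩ := nonempty_interior_of_iUnion_of_closed (fun N => isClosed_closure) hcover
  obtain ⟨_, ⟨c₀, n₀, rfl⟩, -, hcyl⟩ :=
    (PiNat.isTopologicalBasis_cylinders fun _ : ℕ => Bool).exists_subset_of_mem_open ha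
      isOpen_interior
  refine ⟨N, n₀, fun n hn m => ?_⟩
  have approx (b : Bool) : ∃ c ∈ B N, c n = b ∧ ∀ k, k < m → k ≠ n → c k = c₀ k := by
    have hmem : Function.update c₀ n b ∈ closure (B N) := by
      refine interior_subset (hcyl (PiNat.mem_cylinder_iff.2 fun i hi => ?_))
      exact Function.update_of_ne (by omega) _ _
    obtain ⟨c, hc, hcB⟩ := mem_closure_iff.1 hmem _
      (PiNat.isOpen_cylinder _ _ (max m (n + 1))) (PiNat.self_mem_cylinder _ _)
    rw [PiNat.mem_cylinder_iff] at hc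
    refine ⟨c, hcB, ?_, fun k hk hkn => ?_⟩
    · rw [hc n (by omega), Function.update_self]
    · rw [hc k (by omega), Function.update_of_ne hkn]
  obtain ⟨c, hc, hcn, hck⟩ := approx true
  obtain ⟨c', hc', hcn', hck'⟩ := approx false
  exact ⟨_, hc, _, hc', hcn, by simp [hcn'], fun k hk hkn => by simp [hck k hk hkn, hck' k hk hkn]⟩

theorem sum_range_indicator_sub_sum_range_indicator {X : Type u} [AddCommGroup X] (x : ℕ → X)
    {S S' : Set ℕ} {n m : ℕ} (hnm : n < m) (hS : n ∈ S) (hS' : n ∉ S')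
    (h : ∀ k, k < m → k ≠ n → (k ∈ S ↔ k ∈ S')) :
    ∑ k ∈ Finset.range m, S.indicator x k - ∑ k ∈ Finset.range m, S'.indicator x k = x n := by
  rw [← Finset.sum_sub_distrib, Finset.sum_eq_single_of_mem n (Finset.mem_range.2 hnm)]
  · simp [hS, hS']
  · intro k hk hkn
    rw [Set.indicator_eq_indicator (h k (Finset.mem_range.1 hk) hkn) rfl, sub_self]

variable {X : Type u} [AddCommGroup X] [Module ℝ X] [Norm X]

theorem norm_indicator_le [IsQuasinormed X] (S : Set ℕ) (x : ℕ → X) (k : ℕ) :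
    ‖S.indicator x k‖ ≤ ‖x k‖ := by
  by_cases h : k ∈ S <;> simp [h, nonneg]

/-- Gliding hump principle: the two elements are sums of subseries which differ, up to a negligible
tail, in the term of index `n` only. -/
theorem exists_forall_norm_sub_sub_le_of_subseries [IsQuasiBanach X] {ι : Type v}
    {g : ℕ → ι → X} {M : ι → ℝ} (hg : ∀ k i, ‖g k i‖ ≤ M i * ratio X ^ k) {A : ℕ → Set (ι → X)}
    (hA : ∀ (S : Set ℕ) (s : ι → X),
      (∀ i, QTendsto (fun n => ∑ k ∈ Finset.range n, S.indicator (g · i) k) (s i)) →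
        ∃ N, s ∈ A N) :
    ∃ N n₀ : ℕ, ∀ n, n₀ ≤ n → ∀ (F : Finset ι) (ε : ι → ℝ), (∀ i ∈ F, 0 < ε i) →
      ∃ s ∈ A N, ∃ s' ∈ A N, ∀ i ∈ F, ‖g n i - (s i - s' i)‖ ≤ ε i := by
  let r (i : ι) (m : ℕ) : ℝ := modulus X * (2 * modulus X * M i * ratio X ^ m)
  have hsum (S : Set ℕ) (i : ι) : ∃ s : X,
      QTendsto (fun n => ∑ k ∈ Finset.range n, S.indicator (g · i) k) s ∧
        ∀ m, ‖s - ∑ k ∈ Finset.range m, S.indicator (g · i) k‖ ≤ r i m :=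
    IsQuasiBanach.exists_qTendsto_sum fun k => (norm_indicator_le S _ k).trans (hg k i)
  choose s hs hsr using hsum
  obtain ⟨N, n₀, hN⟩ := exists_pair_differing_at_of_iUnion_eq_univ (A := fun N => {S | s S ∈ A N})
    (Set.eq_univ_of_forall fun S => Set.mem_iUnion.2 (hA S (s S) (hs S)))
  refine ⟨N, n₀, fun n hn F ε hε => ?_⟩
  have hlim (i : ι) : Tendsto (fun m => modulus X * (r i m + r i m)) atTop (𝓝 0) := by
    have h := (tendsto_const_mul_ratio_pow X (2 * modulus X * M i)).const_mul (modulus X)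
    simpa using (h.add h).const_mul (modulus X)
  have hsmall : ∀ᶠ m in atTop, ∀ i ∈ F, modulus X * (r i m + r i m) < ε i :=
    (eventually_all_finset F).2 fun i hi => (hlim i).eventually_lt_const (hε i hi)
  obtain ⟨m, hm, hnm⟩ := (hsmall.and (eventually_gt_atTop n)).exists
  obtain ⟨S, hS, S', hS', hnS, hnS', hk⟩ := hN n hn m
  refine ⟨s S, hS, s S', hS', fun i hi => ?_⟩
  calc ‖g n i - (s S i - s S' i)‖
      = ‖(s S' i - ∑ k ∈ Finset.range m, S'.indicator (g · i) k)
          - (s S i - ∑ k ∈ Finset.range m, S.indicator (g · i) k)‖ := by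
        rw [← sum_range_indicator_sub_sum_range_indicator (g · i) hnm hnS hnS' hk]
        congr 1
        abel
    _ ≤ modulus X * (r i m + r i m) := (IsQuasinormed.norm_sub_le _ _).trans
        (mul_le_mul_of_nonneg_left (add_le_add (hsr S' i m) (hsr S i m)) (modulus_nonneg X))
    _ ≤ ε i := (hm i hi).le

end GlidingHump

section OpenMapping

variable {Z : Type u} {X : Type v} [AddCommGroup Z] [Module ℝ Z] [Norm Z]
  [AddCommGroup X] [Module ℝ X] [Norm X]

/-- Sequentially closed submodules for the quasinorm. -/
def IsQClosed (W : Submodule ℝ X) : Prop :=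
  ∀ (s : ℕ → X) (x : X), (∀ n, s n ∈ W) → QTendsto s x → x ∈ W

theorem isQClosed_ker [IsQuasinormed X] {q : Z →ₗ[ℝ] X} (hq : IsBoundedMap q) :
    IsQClosed (LinearMap.ker q) := by
  intro s z hs hz
  refine (hz.map q hq).unique ?_
  simpa [LinearMap.mem_ker.1 (hs _)] using QTendsto.const (0 : X)

theorem exists_approximate_preimage_of_sphere [IsQuasinormed Z] [IsQuasinormed X]
    {A : Z →ₗ[ℝ] X} {W : Submodule ℝ X} {C ε r : ℝ} (hr : 0 < r)
    (h : ∀ x ∈ W, ‖x‖ = r → ∃ z, ‖z‖ ≤ C * r ∧ ‖x - A z‖ ≤ ε * r) {x : X} (hx : x ∈ W) :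
    ∃ z, ‖z‖ ≤ C * ‖x‖ ∧ ‖x - A z‖ ≤ ε * ‖x‖ := by
  obtain rfl | hx0 := eq_or_ne x 0
  · exact ⟨0, by simp, by simp⟩
  have hpos := IsQuasinormed.norm_pos hx0
  have ht : 0 < r * ‖x‖⁻¹ := mul_pos hr (inv_pos.2 (IsQuasinormed.norm_pos hx0))
  obtain ⟨z, hz, hxz⟩ := h ((r * ‖x‖⁻¹) • x) (W.smul_mem _ hx) (by
    rw [mul_smul, IsQuasinormed.smul, norm_inv_norm_smul hx0, abs_of_pos hr, mul_one])
  have hscale : x - A ((r * ‖x‖⁻¹)⁻¹ • z) = (r * ‖x‖⁻¹)⁻¹ • ((r * ‖x‖⁻¹) • x - A z) := by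
    rw [smul_sub, inv_smul_smul₀ ht.ne', map_smul]
  refine ⟨(r * ‖x‖⁻¹)⁻¹ • z, ?_, ?_⟩
  · rw [IsQuasinormed.smul, abs_of_pos (inv_pos.2 ht), inv_mul_le_iff₀ ht]
    exact hz.trans_eq (by field_simp)
  · rw [hscale, IsQuasinormed.smul, abs_of_pos (inv_pos.2 ht), inv_mul_le_iff₀ ht]
    exact hxz.trans_eq (by field_simp)

theorem exists_approximate_preimage [IsQuasinormed Z] [IsQuasiBanach X] {A : Z →ₗ[ℝ] X}
    (hA : IsQClosed (LinearMap.range A)) {ε : ℝ} (hε : 0 < ε) :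
    ∃ C : ℝ, 0 ≤ C ∧ ∀ x ∈ LinearMap.range A, ∃ z, ‖z‖ ≤ C * ‖x‖ ∧ ‖x - A z‖ ≤ ε * ‖x‖ := by
  by_contra! hbad
  have hrpos (n : ℕ) : 0 < ratio X ^ n := pow_pos (ratio_pos X) n
  have hfar (n : ℕ) : ∃ x ∈ LinearMap.range A, ‖x‖ = ratio X ^ n ∧
      ∀ z, ‖z‖ ≤ n → ε * ratio X ^ n < ‖x - A z‖ := by
    obtain ⟨x, hx, hxz⟩ := hbad (n / ratio X ^ n) (by have := hrpos n; positivity)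
    by_contra! hn
    obtain ⟨z, hz, hz'⟩ := exists_approximate_preimage_of_sphere
      (A := A) (C := n / ratio X ^ n) (ε := ε) (hrpos n)
      (fun x hx hxn => by simpa [(hrpos n).ne'] using hn x hx hxn) hx
    exact (hxz z hz).not_ge hz'
  choose x hxA hxn hxz using hfar
  obtain ⟨N, n₀, hN⟩ := exists_forall_norm_sub_sub_le_of_subseries
    (g := fun k (_ : Unit) => x k) (M := 1) (A := fun N => {s | ∃ z, ‖z‖ ≤ N ∧ A z = s ()})
    (fun k _ => by simp [hxn]) fun S s hs => by
      obtain ⟨z, hz⟩ := hA _ _ (fun n => Submodule.sum_mem _ fun k _ => by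
        by_cases hk : k ∈ S
        · simpa only [Set.indicator_of_mem hk] using hxA k
        · simp only [Set.indicator_of_notMem hk, zero_mem]) (hs ())
      obtain ⟨N, hN⟩ := exists_nat_ge ‖z‖
      exact ⟨N, z, hN, hz⟩
  obtain ⟨n₁, hn₁⟩ := exists_nat_ge (modulus Z * (N + N))
  obtain ⟨s, ⟨z, hz, hzs⟩, s', ⟨z', hz', hzs'⟩, h⟩ := hN (max n₀ n₁) (le_max_left _ _)
    {()} (fun _ => ε * ratio X ^ (max n₀ n₁)) fun _ _ => mul_pos hε (hrpos _)
  refine (hxz (max n₀ n₁) (z - z') ?_).not_ge ?_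
  · calc ‖z - z'‖ ≤ modulus Z * (N + N) := (IsQuasinormed.norm_sub_le z z').trans
          (mul_le_mul_of_nonneg_left (add_le_add hz hz') (modulus_nonneg Z))
      _ ≤ (max n₀ n₁ : ℕ) := hn₁.trans (Nat.cast_le.2 (le_max_right _ _))
  · simpa [hzs, hzs'] using h ()

theorem exists_preimage_of_approximate [IsQuasiBanach Z] [IsQuasinormed X] {A : Z →ₗ[ℝ] X}
    (hA : IsBoundedMap A) {C : ℝ} (hC : 0 ≤ C)
    (h : ∀ x ∈ LinearMap.range A, ∃ z, ‖z‖ ≤ C * ‖x‖ ∧ ‖x - A z‖ ≤ ratio Z * ‖x‖)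
    {x : X} (hx : x ∈ LinearMap.range A) :
    ∃ z, A z = x ∧ ‖z‖ ≤ modulus Z * (2 * modulus Z * C) * ‖x‖ := by
  choose! φ hφ hφA using h
  let residual (n : ℕ) : X := (fun y => y - A (φ y))^[n] x
  have hsucc (n : ℕ) : residual (n + 1) = residual n - A (φ (residual n)) :=
    Function.iterate_succ_apply' _ _ _
  have hmem (n : ℕ) : residual n ∈ LinearMap.range A := by
    induction n with
    | zero => exact hx
    | succ n ih => exact hsucc n ▸ sub_mem ih (LinearMap.mem_range_self A _)
  have hnorm (n : ℕ) : ‖residual n‖ ≤ ‖x‖ * ratio Z ^ n := by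
    induction n with
    | zero => simp [residual]
    | succ n ih =>
      rw [hsucc, pow_succ', mul_left_comm]
      exact (hφA _ (hmem n)).trans (mul_le_mul_of_nonneg_left ih (ratio_pos Z).le)
  have hterm (n : ℕ) : ‖φ (residual n)‖ ≤ C * ‖x‖ * ratio Z ^ n := by
    rw [mul_assoc]
    exact (hφ _ (hmem n)).trans (mul_le_mul_of_nonneg_left (hnorm n) hC)
  have hpartial (n : ℕ) : A (∑ k ∈ Finset.range n, φ (residual k)) = x - residual n := by
    induction n with
    | zero => simp [residual]
    | succ n ih => rw [Finset.sum_range_succ, map_add, ih, hsucc]; abel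
  obtain ⟨z, hz, hztail⟩ := IsQuasiBanach.exists_qTendsto_sum hterm
  refine ⟨z, (hz.map A hA).unique ?_, ?_⟩
  · simp only [hpartial]
    refine squeeze_zero (fun _ => nonneg _) (fun n => ?_) (tendsto_const_mul_ratio_pow Z ‖x‖)
    simpa using hnorm n
  · simpa [mul_assoc] using hztail 0

theorem exists_bounded_preimage [IsQuasiBanach Z] [IsQuasiBanach X] {A : Z →ₗ[ℝ] X}
    (hA : IsBoundedMap A) (hcl : IsQClosed (LinearMap.range A)) :
    ∃ C : ℝ, 0 ≤ C ∧ ∀ x ∈ LinearMap.range A, ∃ z, A z = x ∧ ‖z‖ ≤ C * ‖x‖ := by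
  obtain ⟨C, hC, h⟩ := exists_approximate_preimage hcl (ratio_pos Z)
  have := modulus_nonneg Z
  exact ⟨_, by positivity, fun x hx => exists_preimage_of_approximate hA hC h hx⟩

theorem exists_norm_le_of_injective [IsQuasiBanach Z] [IsQuasiBanach X] {j : Z →ₗ[ℝ] X}
    (hj : IsBoundedMap j) (hinj : Function.Injective j) (hcl : IsQClosed (LinearMap.range j)) :
    ∃ C : ℝ, 0 ≤ C ∧ ∀ z, ‖z‖ ≤ C * ‖j z‖ := by
  obtain ⟨C, hC, h⟩ := exists_bounded_preimage hj hcl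
  refine ⟨C, hC, fun z => ?_⟩
  obtain ⟨z', hz', hnorm⟩ := h (j z) (LinearMap.mem_range_self j z)
  exact hinj hz' ▸ hnorm

end OpenMapping

section QuasilinearMaps

variable {X : Type u} {Y : Type v} [AddCommGroup X] [AddCommGroup Y]

namespace IsHomogeneous

variable [Module ℝ X] [Module ℝ Y] {f : X → Y}

theorem map_zero (hf : IsHomogeneous f) : f 0 = 0 := by
  simpa using hf 0 0

theorem const_smul (hf : IsHomogeneous f) (c : ℝ) : IsHomogeneous fun x => c • f x := fun t x => by
  simp only [hf t x, smul_comm c t]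

theorem sub_linearMap (hf : IsHomogeneous f) (l : X →ₗ[ℝ] Y) :
    IsHomogeneous fun x => f x - l x := fun t x => by
  simp only [hf t x, map_smul, smul_sub]

theorem norm_le_of_sphere [Norm X] [IsQuasinormed X] [Norm Y] [IsQuasinormed Y]
    (hf : IsHomogeneous f) {C : ℝ} (h : ∀ x, ‖x‖ = 1 → ‖f x‖ ≤ C) (x : X) : ‖f x‖ ≤ C * ‖x‖ := by
  obtain rfl | hx := eq_or_ne x 0
  · simp [hf.map_zero]
  · have hpos := IsQuasinormed.norm_pos hx
    have hsphere := h _ (norm_inv_norm_smul hx)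
    rwa [hf, IsQuasinormed.smul, abs_of_pos (inv_pos.2 hpos), inv_mul_le_iff₀ hpos, mul_comm]
      at hsphere

end IsHomogeneous

variable [Norm X] [Norm Y]

/-- The additivity defect of `f` is at most `Q`, that is `Q[f] ≤ Q`. -/
def DefectLE (f : X → Y) (Q : ℝ) : Prop :=
  ∀ x y, ‖f (x + y) - f x - f y‖ ≤ Q * (‖x‖ + ‖y‖)

theorem DefectLE.quasilinConst_le {f : X → Y} {Q : ℝ} (hf : DefectLE f Q) (hQ : 0 ≤ Q) :
    quasilinConst f ≤ ENNReal.ofReal Q :=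
  sInf_le fun x y => by
    rw [← ENNReal.ofReal_mul hQ]
    exact ENNReal.ofReal_le_ofReal (hf x y)

variable [Module ℝ X] [Module ℝ Y]

/-- The map `f` is at distance at most `C` from some (possibly unbounded) linear map. -/
def NearLinear (f : X → Y) (C : ℝ) : Prop := ∃ l : X →ₗ[ℝ] Y, ∀ x, ‖f x - l x‖ ≤ C * ‖x‖

end QuasilinearMaps

namespace IsBoundedMap

theorem exists_nonneg {X : Type u} {Y : Type v} [AddCommGroup X] [Module ℝ X] [Norm X]
    [IsQuasinormed X] [Norm Y] {f : X → Y} (hf : IsBoundedMap f) :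
    ∃ M : ℝ, 0 ≤ M ∧ ∀ x, ‖f x‖ ≤ M * ‖x‖ := by
  obtain ⟨M, hM⟩ := hf
  exact ⟨max M 0, le_max_right _ _, fun x => (hM x).trans
    (mul_le_mul_of_nonneg_right (le_max_left _ _) (nonneg x))⟩

theorem comp {X : Type u} {Y : Type v} {Z : Type w} [Norm X] [AddCommGroup Y] [Module ℝ Y] [Norm Y]
    [IsQuasinormed Y] [Norm Z] {g : Y → Z} {f : X → Y} (hg : IsBoundedMap g)
    (hf : IsBoundedMap f) : IsBoundedMap fun x => g (f x) := by
  obtain ⟨M, hM, hgM⟩ := hg.exists_nonneg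
  obtain ⟨N, hN⟩ := hf
  refine ⟨M * N, fun x => ?_⟩
  rw [mul_assoc]
  exact (hgM _).trans (mul_le_mul_of_nonneg_left (hN x) hM)

variable {X : Type u} {Y : Type v} [Norm X] [AddCommGroup Y] [Module ℝ Y] [Norm Y]
  [IsQuasinormed Y] {f g : X → Y}

theorem const_smul (hf : IsBoundedMap f) (c : ℝ) : IsBoundedMap fun x => c • f x := by
  obtain ⟨M, hM⟩ := hf
  refine ⟨|c| * M, fun x => ?_⟩
  rw [IsQuasinormed.smul, mul_assoc]
  exact mul_le_mul_of_nonneg_left (hM x) (abs_nonneg c)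

theorem sub (hf : IsBoundedMap f) (hg : IsBoundedMap g) : IsBoundedMap fun x => f x - g x := by
  obtain ⟨M, hM⟩ := hf
  obtain ⟨N, hN⟩ := hg
  refine ⟨modulus Y * (M + N), fun x => ?_⟩
  rw [mul_assoc, add_mul]
  exact (IsQuasinormed.norm_sub_le _ _).trans
    (mul_le_mul_of_nonneg_left (add_le_add (hM x) (hN x)) (modulus_nonneg Y))

theorem add (hf : IsBoundedMap f) (hg : IsBoundedMap g) : IsBoundedMap fun x => f x + g x := by
  simpa using hf.sub (hg.const_smul (-1))

theorem exists_defectLE {X : Type u} [AddCommGroup X] [Module ℝ X] [Norm X] [IsQuasinormed X]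
    {f : X → Y} (hf : IsBoundedMap f) : ∃ Q : ℝ, 0 ≤ Q ∧ DefectLE f Q := by
  obtain ⟨M, hM, hfM⟩ := hf.exists_nonneg
  have hX := modulus_nonneg X
  have hY := modulus_nonneg Y
  refine ⟨modulus Y * (modulus Y * (M * modulus X + M) + M), by positivity, fun x y => ?_⟩
  have hx := nonneg x
  have hy := nonneg y
  calc ‖f (x + y) - f x - f y‖
    _ ≤ modulus Y * (modulus Y * (‖f (x + y)‖ + ‖f x‖) + ‖f y‖) := by
        refine (IsQuasinormed.norm_sub_le _ _).trans ?_
        gcongr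
        exact IsQuasinormed.norm_sub_le _ _
    _ ≤ modulus Y * (modulus Y * (M * (modulus X * (‖x‖ + ‖y‖)) + M * (‖x‖ + ‖y‖)) +
          M * (‖x‖ + ‖y‖)) := by
        gcongr
        · exact (hfM _).trans (mul_le_mul_of_nonneg_left (IsQuasinormed.norm_add_le x y) hM)
        · exact (hfM x).trans (mul_le_mul_of_nonneg_left (by linarith) hM)
        · exact (hfM y).trans (mul_le_mul_of_nonneg_left (by linarith) hM)
    _ = _ := by ring

end IsBoundedMap

namespace DefectLE

theorem mono {X : Type u} {Y : Type v} [AddCommGroup X] [Module ℝ X] [Norm X] [IsQuasinormed X]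
    [AddCommGroup Y] [Norm Y] {f : X → Y} {Q Q' : ℝ} (hf : DefectLE f Q) (h : Q ≤ Q') :
    DefectLE f Q' := fun x y =>
  (hf x y).trans (mul_le_mul_of_nonneg_right h (add_nonneg (nonneg _) (nonneg _)))

variable {X : Type u} {Y : Type v} [AddCommGroup X] [Norm X] [AddCommGroup Y] [Module ℝ Y]
  [Norm Y] {f : X → Y} {Q : ℝ}

theorem sub_linearMap [Module ℝ X] (hf : DefectLE f Q) (l : X →ₗ[ℝ] Y) :
    DefectLE (fun x => f x - l x) Q := fun x y => by
  have hcancel : f (x + y) - l (x + y) - (f x - l x) - (f y - l y) = f (x + y) - f x - f y := by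
    rw [map_add]; abel
  simpa only [hcancel] using hf x y

theorem linearMap_comp {W : Type w} [AddCommGroup W] [Module ℝ W] [Norm W] (hf : DefectLE f Q)
    {l : Y →ₗ[ℝ] W} {M : ℝ} (hM : 0 ≤ M) (hl : ∀ y, ‖l y‖ ≤ M * ‖y‖) :
    DefectLE (fun x => l (f x)) (M * Q) := fun x y => by
  rw [← map_sub, ← map_sub, mul_assoc]
  exact (hl _).trans (mul_le_mul_of_nonneg_left (hf x y) hM)

variable [IsQuasinormed Y]

theorem const_smul (hf : DefectLE f Q) (c : ℝ) : DefectLE (fun x => c • f x) (|c| * Q) :=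
  hf.linearMap_comp (l := c • LinearMap.id) (abs_nonneg c) fun y => (IsQuasinormed.smul c y).le

theorem nearLinear [Module ℝ X] (h : DefectLE f 0) (hf : IsHomogeneous f) : NearLinear f 0 := by
  have hadd (x y : X) : f (x + y) = f x + f y := by
    have := eq_zero_of_norm_nonpos (by simpa using h x y)
    rwa [sub_sub, sub_eq_zero] at this
  exact ⟨{ toFun := f, map_add' := hadd, map_smul' := hf },
    fun x => by
      rw [zero_mul]
      exact ((congrArg norm (sub_self (f x))).trans IsQuasinormed.norm_zero).le⟩

end DefectLE

section Approximation

variable {X : Type u} {Y : Type v} [AddCommGroup X] [Module ℝ X] [Norm X]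
  [AddCommGroup Y] [Module ℝ Y] [Norm Y] {f : X → Y}

namespace NearLinear

variable {C C' : ℝ}

theorem mono [IsQuasinormed X] (hf : NearLinear f C) (h : C ≤ C') : NearLinear f C' := by
  obtain ⟨l, hl⟩ := hf
  exact ⟨l, fun x => (hl x).trans (mul_le_mul_of_nonneg_right h (nonneg x))⟩

theorem const_smul [IsQuasinormed Y] (hf : NearLinear f C) (c : ℝ) :
    NearLinear (fun x => c • f x) (|c| * C) := by
  obtain ⟨l, hl⟩ := hf
  refine ⟨c • l, fun x => ?_⟩
  rw [LinearMap.smul_apply, ← smul_sub, IsQuasinormed.smul, mul_assoc]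
  exact mul_le_mul_of_nonneg_left (hl x) (abs_nonneg c)

theorem of_sub_linearMap (l : X →ₗ[ℝ] Y) (hf : NearLinear (fun x => f x - l x) C) :
    NearLinear f C := by
  obtain ⟨m, hm⟩ := hf
  exact ⟨l + m, fun x => by simpa [sub_sub] using hm x⟩

end NearLinear

theorem approxK₀_le_approxK : approxK₀ X Y ≤ approxK X Y :=
  sInf_le_sInf fun _ hC f hf _ => hC f hf

/-- The homogeneous maps with the property `P` are approximated by linear maps, uniformly with
respect to their additivity defects. -/
def UniformlyApproximable (P : (X → Y) → Prop) : Prop :=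
  ∃ C : ℝ, 0 ≤ C ∧ ∀ f : X → Y, IsHomogeneous f → P f →
    ∀ Q : ℝ, 0 ≤ Q → DefectLE f Q → NearLinear f (C * Q)

section Quasinormed

variable [IsQuasinormed X]

namespace IsQuasilinear

theorem exists_defectLE (hf : IsQuasilinear f) : ∃ Q : ℝ, 0 ≤ Q ∧ DefectLE f Q := by
  obtain ⟨Q, hQ⟩ := hf.2
  exact ⟨max Q 0, le_max_right _ _, DefectLE.mono hQ (le_max_left _ _)⟩

theorem quasilinConst_ne_top (hf : IsQuasilinear f) : quasilinConst f ≠ ⊤ := by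
  obtain ⟨Q, hQ, h⟩ := hf.exists_defectLE
  exact ((h.quasilinConst_le hQ).trans_lt ENNReal.ofReal_lt_top).ne

theorem defectLE_quasilinConst (hf : IsQuasilinear f) :
    DefectLE f (quasilinConst f).toReal := by
  intro x y
  obtain h0 | hpos := (add_nonneg (nonneg x) (nonneg y)).eq_or_lt
  · obtain ⟨Q, -, h⟩ := hf.exists_defectLE
    simpa [← h0] using h x y
  · have hpos' : ENNReal.ofReal (‖x‖ + ‖y‖) ≠ 0 := by simpa using hpos
    have h : ENNReal.ofReal ‖f (x + y) - f x - f y‖ / ENNReal.ofReal (‖x‖ + ‖y‖)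
        ≤ quasilinConst f :=
      le_sInf fun Q hQ => (ENNReal.div_le_iff hpos' ENNReal.ofReal_ne_top).2 (hQ x y)
    rwa [ENNReal.div_le_iff hpos' ENNReal.ofReal_ne_top,
      ← ENNReal.ofReal_toReal hf.quasilinConst_ne_top, ← ENNReal.ofReal_mul ENNReal.toReal_nonneg,
      ENNReal.ofReal_le_ofReal_iff (by positivity)] at h

theorem isTrivialMap (hf : IsQuasilinear f) (h : approxK X Y < ⊤) :
    IsTrivialMap f := by
  obtain ⟨C, hC, hCtop⟩ := sInf_lt_iff.1 h
  obtain ⟨l, hl⟩ := hC f hf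
  exact ⟨l, hl.trans_lt (ENNReal.mul_lt_top hCtop hf.quasilinConst_ne_top.lt_top)⟩

end IsQuasilinear

variable [IsQuasinormed Y]

theorem homNorm_le_ofReal_iff (hf : IsHomogeneous f) {C : ℝ} (hC : 0 ≤ C) :
    homNorm f ≤ ENNReal.ofReal C ↔ ∀ x, ‖f x‖ ≤ C * ‖x‖ := by
  rw [homNorm, iSup₂_le_iff]
  simp only [ENNReal.ofReal_le_ofReal_iff hC]
  exact ⟨hf.norm_le_of_sphere, fun h x hx => by simpa [hx] using h x⟩

theorem exists_homNorm_sub_le_ofReal_iff (hf : IsHomogeneous f) {C : ℝ} (hC : 0 ≤ C) :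
    (∃ l : X →ₗ[ℝ] Y, homNorm (fun x => f x - l x) ≤ ENNReal.ofReal C) ↔ NearLinear f C :=
  exists_congr fun l => homNorm_le_ofReal_iff (hf.sub_linearMap l) hC

theorem isTrivialMap_iff_exists_nearLinear (hf : IsHomogeneous f) :
    IsTrivialMap f ↔ ∃ C, NearLinear f C := by
  constructor
  · rintro ⟨l, hl⟩
    exact ⟨_, (exists_homNorm_sub_le_ofReal_iff hf ENNReal.toReal_nonneg).1
      ⟨l, (ENNReal.ofReal_toReal hl.ne).ge⟩⟩
  · rintro ⟨C, hC⟩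
    obtain ⟨l, hl⟩ := (exists_homNorm_sub_le_ofReal_iff hf (le_max_right C 0)).2
      (hC.mono (le_max_left _ _))
    exact ⟨l, hl.trans_lt ENNReal.ofReal_lt_top⟩

theorem sInf_approximation_constants_lt_top_iff {P : (X → Y) → Prop} :
    sInf {C : ℝ≥0∞ | ∀ f : X → Y, IsQuasilinear f → P f →
      ∃ l : X →ₗ[ℝ] Y, homNorm (fun x => f x - l x) ≤ C * quasilinConst f} < ⊤ ↔
    UniformlyApproximable P := by
  rw [sInf_lt_iff]
  constructor
  · rintro ⟨C, hC, hCtop⟩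
    refine ⟨C.toReal, ENNReal.toReal_nonneg, fun f hf hPf Q hQ hfQ => ?_⟩
    obtain ⟨l, hl⟩ := hC f ⟨hf, Q, hfQ⟩ hPf
    refine (exists_homNorm_sub_le_ofReal_iff hf (by positivity)).1 ⟨l, hl.trans ?_⟩
    rw [ENNReal.ofReal_mul ENNReal.toReal_nonneg, ENNReal.ofReal_toReal hCtop.ne]
    exact mul_le_mul_right (hfQ.quasilinConst_le hQ) C
  · rintro ⟨C, hC, h⟩
    refine ⟨ENNReal.ofReal C, fun f hf hPf => ?_, ENNReal.ofReal_lt_top⟩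
    rw [← ENNReal.ofReal_toReal hf.quasilinConst_ne_top, ← ENNReal.ofReal_mul hC]
    exact (exists_homNorm_sub_le_ofReal_iff hf.1 (by positivity)).2
      (h f hf.1 hPf _ ENNReal.toReal_nonneg hf.defectLE_quasilinConst)

theorem approxK_lt_top_iff :
    approxK X Y < ⊤ ↔ UniformlyApproximable fun _ : X → Y => True := by
  simp [← sInf_approximation_constants_lt_top_iff, approxK]

theorem approxK₀_lt_top_iff :
    approxK₀ X Y < ⊤ ↔ UniformlyApproximable (IsBoundedMap : (X → Y) → Prop) :=
  sInf_approximation_constants_lt_top_iff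

theorem exists_defectLE_not_nearLinear {P : (X → Y) → Prop}
    (hP : ∀ (c : ℝ) (f : X → Y), P f → P fun x => c • f x) (h : ¬ UniformlyApproximable P)
    {δ : ℝ} (hδ : 0 < δ) (C : ℝ) :
    ∃ f : X → Y, IsHomogeneous f ∧ P f ∧ DefectLE f δ ∧ ¬ NearLinear f C := by
  rw [UniformlyApproximable] at h
  push Not at h
  obtain ⟨f, hf, hPf, Q, hQ, hfQ, hfar⟩ := h (max (C / δ) 0) (le_max_right _ _)
  obtain rfl | hQ := hQ.eq_or_lt
  · exact absurd (hfQ.nearLinear hf) (by simpa using hfar)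
  refine ⟨fun x => (δ / Q) • f x, hf.const_smul _, hP _ _ hPf, ?_, fun hnear => hfar ?_⟩
  · simpa [abs_of_pos (div_pos hδ hQ), hQ.ne'] using hfQ.const_smul (δ / Q)
  · have hback : NearLinear f (Q / δ * C) := by
      simpa [smul_smul, abs_of_pos (div_pos hQ hδ), hQ.ne', hδ.ne'] using hnear.const_smul (Q / δ)
    refine hback.mono ?_
    calc Q / δ * C = C / δ * Q := by ring
      _ ≤ max (C / δ) 0 * Q := mul_le_mul_of_nonneg_right (le_max_left _ _) hQ.le

end Quasinormed

end Approximation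

/-- The twisted sum of `Y` and `X` along `f : X → Y`, quasinormed by `‖y - f x‖ + ‖x‖`. The map `f`
only enters through the quasinorm. -/
def TwistedSum {X : Type u} {Y : Type v} (_ : X → Y) : Type (max u v) := Y × X

namespace TwistedSum

variable {X : Type u} {Y : Type v} [AddCommGroup X] [Module ℝ X] [AddCommGroup Y] [Module ℝ Y]

section Linear

variable (f : X → Y)

instance : AddCommGroup (TwistedSum f) := inferInstanceAs (AddCommGroup (Y × X))

instance : Module ℝ (TwistedSum f) := inferInstanceAs (Module ℝ (Y × X))

/-- The inclusion of `Y`. -/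
def inl : Y →ₗ[ℝ] TwistedSum f := LinearMap.inl ℝ Y X

/-- The linear, in general unbounded, section of the quotient map. -/
def inr : X →ₗ[ℝ] TwistedSum f := LinearMap.inr ℝ Y X

/-- The linear, in general unbounded, projection onto `Y`. -/
def fst : TwistedSum f →ₗ[ℝ] Y := LinearMap.fst ℝ Y X

/-- The quotient map onto `X`. -/
def snd : TwistedSum f →ₗ[ℝ] X := LinearMap.snd ℝ Y X

/-- The norm-preserving, in general nonlinear, section of the quotient map. -/
def lift (x : X) : TwistedSum f := inl f (f x) + inr f x

variable {f}

@[simp] theorem fst_inl (y : Y) : fst f (inl f y) = y := rfl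

@[simp] theorem snd_inl (y : Y) : snd f (inl f y) = 0 := rfl

@[simp] theorem fst_inr (x : X) : fst f (inr f x) = 0 := rfl

@[simp] theorem snd_inr (x : X) : snd f (inr f x) = x := rfl

@[simp] theorem fst_lift (x : X) : fst f (lift f x) = f x := by simp [lift]

@[simp] theorem snd_lift (x : X) : snd f (lift f x) = x := by simp [lift]

theorem eq_of_fst_of_snd {z z' : TwistedSum f} (hfst : fst f z = fst f z')
    (hsnd : snd f z = snd f z') : z = z' :=
  Prod.ext hfst hsnd

theorem inl_injective : Function.Injective (inl f) := LinearMap.inl_injective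

theorem snd_surjective : Function.Surjective (snd f) := Prod.snd_surjective

theorem range_inl_eq_ker_snd : LinearMap.range (inl f) = LinearMap.ker (snd f) :=
  LinearMap.range_inl ℝ Y X

end Linear

section Quasinorm

variable [Norm X] [Norm Y] {f : X → Y}

instance (f : X → Y) : Norm (TwistedSum f) := ⟨fun z => ‖fst f z - f (snd f z)‖ + ‖snd f z‖⟩

theorem norm_def (z : TwistedSum f) : ‖z‖ = ‖fst f z - f (snd f z)‖ + ‖snd f z‖ := rfl

section QuotientMap

variable [IsQuasinormed Y]

theorem norm_lift (x : X) : ‖lift f x‖ = ‖x‖ := by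
  simp [norm_def]

theorem isBoundedMap_snd : IsBoundedMap (snd f) :=
  ⟨1, fun z => by rw [one_mul]; exact le_add_of_nonneg_left (nonneg _)⟩

end QuotientMap

variable [IsQuasinormed X]

theorem norm_inl (hf : IsHomogeneous f) (y : Y) : ‖inl f y‖ = ‖y‖ := by
  simp [norm_def, hf.map_zero]

theorem isBoundedMap_inl (hf : IsHomogeneous f) : IsBoundedMap (inl f) :=
  ⟨1, fun y => by rw [norm_inl hf, one_mul]⟩

variable [IsQuasinormed Y]

theorem norm_add_le_of_defectLE {Q : ℝ} (hQ : 0 ≤ Q) (hf : DefectLE f Q) (z z' : TwistedSum f) :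
    ‖z + z'‖ ≤ (modulus Y * (modulus Y + Q) + modulus X) * (‖z‖ + ‖z'‖) := by
  simp only [norm_def, map_add]
  set y := fst f z
  set y' := fst f z'
  set x := snd f z
  set x' := snd f z'
  have hY := modulus_nonneg Y
  have hX := modulus_nonneg X
  have hsplit : y + y' - f (x + x') = (y - f x) + (y' - f x') - (f (x + x') - f x - f x') := by
    abel
  have hfst : ‖y + y' - f (x + x')‖ ≤
      modulus Y * (modulus Y * (‖y - f x‖ + ‖y' - f x'‖) + Q * (‖x‖ + ‖x'‖)) := by
    rw [hsplit]
    exact (IsQuasinormed.norm_sub_le _ _).trans (mul_le_mul_of_nonneg_left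
      (add_le_add (IsQuasinormed.norm_add_le _ _) (hf x x')) hY)
  have hfst_nonneg := add_nonneg (nonneg (y - f x)) (nonneg (y' - f x'))
  have hsnd_nonneg := add_nonneg (nonneg x) (nonneg x')
  have hcross : 0 ≤ (modulus Y * Q + modulus X) * (‖y - f x‖ + ‖y' - f x'‖) +
      modulus Y * modulus Y * (‖x‖ + ‖x'‖) := by positivity
  linarith [IsQuasinormed.norm_add_le x x']

theorem isQuasinormed (hf : IsQuasilinear f) : IsQuasinormed (TwistedSum f) where
  nonneg z := add_nonneg (nonneg _) (nonneg _)
  eq_zero_iff z := by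
    rw [norm_def, add_eq_zero_iff_of_nonneg (nonneg _) (nonneg _), eq_zero_iff, eq_zero_iff]
    constructor
    · rintro ⟨hfst, hsnd⟩
      rw [hsnd, hf.1.map_zero, sub_zero] at hfst
      exact eq_of_fst_of_snd hfst hsnd
    · rintro rfl
      simp [hf.1.map_zero]
  smul t z := by
    rw [norm_def, norm_def, map_smul, map_smul, hf.1, ← smul_sub, IsQuasinormed.smul,
      IsQuasinormed.smul, mul_add]
  add_le := by
    obtain ⟨Q, hQ, hdefect⟩ := hf.exists_defectLE
    exact ⟨_, norm_add_le_of_defectLE hQ hdefect⟩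

end Quasinorm

section Completeness

variable [Norm X] [IsQuasiBanach X] [Norm Y] [IsQuasiBanach Y] {f : X → Y}

theorem isQuasiBanach (hf : IsQuasilinear f) : IsQuasiBanach (TwistedSum f) := by
  have := isQuasinormed hf
  refine ⟨fun z hz => ?_⟩
  replace hz : QCauchy z := QCauchy.iff_forall_exists.2 hz
  obtain ⟨x, hx⟩ := IsQuasiBanach.exists_qTendsto (hz.map (snd f) isBoundedMap_snd)
  -- Subtracting a null sequence puts all the terms in the fibre over `x`, a translate of `Y`.
  let w (n : ℕ) : TwistedSum f := lift f (snd f (z n) - x)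
  have hw : QTendsto w 0 := by simpa only [QTendsto, w, sub_zero, norm_lift] using hx
  let y (n : ℕ) : Y := fst f (z n - w n)
  have hfibre (n : ℕ) : z n - w n = inl f (y n) + inr f x :=
    eq_of_fst_of_snd (by simp [y]) (by simp [w])
  have hy : QCauchy y := by
    refine (hz.sub hw.qCauchy).congr fun p => ?_
    simp only [hfibre]
    rw [add_sub_add_right_eq_sub, ← map_sub, norm_inl hf.1]
  obtain ⟨y₀, hy₀⟩ := IsQuasiBanach.exists_qTendsto hy
  have hlim := ((hy₀.map (inl f) (isBoundedMap_inl hf.1)).add (.const (inr f x))).add hw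
  simp only [← hfibre, sub_add_cancel] at hlim
  exact ⟨_, hlim⟩

theorem isTrivialMap (h : EveryExtensionSplits X Y) (hf : IsQuasilinear f) : IsTrivialMap f := by
  have := isQuasiBanach hf
  obtain ⟨r, ⟨M, hM⟩, hr⟩ := h (TwistedSum f) (inl f) (snd f) (isBoundedMap_inl hf.1)
    isBoundedMap_snd inl_injective range_inl_eq_ker_snd snd_surjective
  refine (isTrivialMap_iff_exists_nearLinear hf.1).2 ⟨M, -(r ∘ₗ inr f), fun x => ?_⟩
  have hr_lift : r (lift f x) = f x - (-(r ∘ₗ inr f)) x := by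
    rw [lift, map_add, LinearMap.neg_apply, sub_neg_eq_add]
    exact congrArg (· + r (inr f x)) (LinearMap.congr_fun hr (f x))
  rw [← hr_lift, ← norm_lift (f := f) x]
  exact hM _

end Completeness

end TwistedSum

section Homogenization

variable {X : Type u} [AddCommGroup X] [Module ℝ X] [Norm X]

open Classical in
/-- A norm-one vector depending only on the line spanned by `x`; it is `0` when `x = 0`. -/
noncomputable def lineUnit (x : X) : X :=
  if h : x = 0 then 0
  else ‖(Projectivization.mk ℝ x h).rep‖⁻¹ • (Projectivization.mk ℝ x h).rep

open Classical in
/-- The coordinate of `x` with respect to `lineUnit x`. -/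
noncomputable def lineCoord (x : X) : ℝ :=
  if x = ‖x‖ • lineUnit x then ‖x‖ else -‖x‖

/-- The homogeneous map which agrees with `φ` at the vectors `lineUnit x`. -/
noncomputable def homogenize {Y : Type v} [AddCommGroup Y] [Module ℝ Y] (φ : X → Y) (x : X) : Y :=
  lineCoord x • φ (lineUnit x)

@[simp] theorem lineUnit_zero : lineUnit (0 : X) = 0 := dif_pos rfl

theorem lineUnit_smul {t : ℝ} (ht : t ≠ 0) (x : X) : lineUnit (t • x) = lineUnit x := by
  obtain rfl | hx := eq_or_ne x 0
  · simp
  have hline : Projectivization.mk ℝ (t • x) (smul_ne_zero ht hx) = Projectivization.mk ℝ x hx :=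
    (Projectivization.mk_eq_mk_iff' ..).2 ⟨t, rfl⟩
  simp only [lineUnit, dif_neg hx, dif_neg (smul_ne_zero ht hx), hline]

variable [IsQuasinormed X]

theorem norm_lineUnit {x : X} (hx : x ≠ 0) : ‖lineUnit x‖ = 1 := by
  rw [lineUnit, dif_neg hx]
  exact norm_inv_norm_smul (Projectivization.rep_nonzero _)

theorem norm_lineUnit_le_one (x : X) : ‖lineUnit x‖ ≤ 1 := by
  obtain rfl | hx := eq_or_ne x 0
  · simp
  · exact (norm_lineUnit hx).le

theorem abs_lineCoord (x : X) : |lineCoord x| = ‖x‖ := by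
  unfold lineCoord
  split_ifs <;> simp [abs_of_nonneg (nonneg x)]

theorem exists_smul_lineUnit (x : X) : ∃ t : ℝ, t • lineUnit x = x := by
  obtain rfl | hx := eq_or_ne x 0
  · exact ⟨0, zero_smul ..⟩
  obtain ⟨a, ha⟩ := Projectivization.exists_smul_eq_mk_rep ℝ x hx
  have hrep := IsQuasinormed.norm_pos (Projectivization.mk ℝ x hx).rep_nonzero
  refine ⟨(a⁻¹ : ℝˣ) * ‖(Projectivization.mk ℝ x hx).rep‖, ?_⟩
  rw [lineUnit, dif_neg hx, smul_smul, mul_assoc, mul_inv_cancel₀ hrep.ne', mul_one, ← ha]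
  exact inv_smul_smul a x

theorem lineCoord_smul_lineUnit (x : X) : lineCoord x • lineUnit x = x := by
  obtain rfl | hx := eq_or_ne x 0
  · simp
  obtain ⟨t, ht⟩ := exists_smul_lineUnit x
  have habs : |t| = ‖x‖ := by
    rw [← mul_one |t|, ← norm_lineUnit hx, ← IsQuasinormed.smul, ht]
  unfold lineCoord
  split_ifs with h
  · exact h.symm
  · obtain rfl | rfl := eq_or_eq_neg_of_abs_eq habs
    · exact absurd ht.symm h
    · exact ht

theorem lineCoord_smul (t : ℝ) (x : X) : lineCoord (t • x) = t * lineCoord x := by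
  obtain rfl | ht := eq_or_ne t 0
  · simpa using abs_lineCoord (0 : X)
  obtain rfl | hx := eq_or_ne x 0
  · have h0 : lineCoord (0 : X) = 0 := by simpa using abs_lineCoord (0 : X)
    simp [h0]
  have hne : lineUnit x ≠ 0 := fun h => by simpa [h] using norm_lineUnit hx
  refine smul_left_injective ℝ hne ?_
  simp only
  rw [mul_smul, lineCoord_smul_lineUnit, ← lineUnit_smul ht, lineCoord_smul_lineUnit]

theorem isHomogeneous_homogenize {Y : Type v} [AddCommGroup Y] [Module ℝ Y] (φ : X → Y) :
    IsHomogeneous (homogenize φ) := by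
  intro t x
  obtain rfl | ht := eq_or_ne t 0
  · rw [homogenize, lineCoord_smul, zero_mul, zero_smul, zero_smul]
  · rw [homogenize, lineCoord_smul, lineUnit_smul ht, mul_smul, homogenize]

theorem exists_homogeneous_section {Z : Type v} [AddCommGroup Z] [Module ℝ Z] [Norm Z]
    [IsQuasinormed Z] {q : Z →ₗ[ℝ] X} {C : ℝ} (hC : 0 ≤ C)
    (h : ∀ x, ∃ z, q z = x ∧ ‖z‖ ≤ C * ‖x‖) :
    ∃ B : X → Z, IsHomogeneous B ∧ (∀ x, q (B x) = x) ∧ IsBoundedMap B := by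
  choose φ hqφ hφ using h
  refine ⟨homogenize φ, isHomogeneous_homogenize φ, fun x => ?_, C, fun x => ?_⟩
  · rw [homogenize, map_smul, hqφ, lineCoord_smul_lineUnit]
  · rw [homogenize, IsQuasinormed.smul, abs_lineCoord, mul_comm]
    refine mul_le_mul_of_nonneg_right ((hφ _).trans ?_) (nonneg x)
    exact mul_le_of_le_one_right hC (norm_lineUnit_le_one x)

end Homogenization

section Extensions

variable {X : Type u} {Y : Type v} {Z : Type w} [AddCommGroup X] [Module ℝ X] [Norm X]
  [AddCommGroup Y] [Module ℝ Y] [Norm Y] [AddCommGroup Z] [Module ℝ Z] [Norm Z]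

theorem isQuasilinear_comp_section [IsQuasinormed X] [IsQuasinormed Z] {q : Z →ₗ[ℝ] X}
    {s : Z →ₗ[ℝ] Y} {C : ℝ} (hC : 0 ≤ C) (hs : ∀ z, q z = 0 → ‖s z‖ ≤ C * ‖z‖) {B : X → Z}
    (hB : IsHomogeneous B) (hqB : ∀ x, q (B x) = x) (hBbd : IsBoundedMap B) :
    IsQuasilinear fun x => s (B x) := by
  refine ⟨fun t x => by simp only [hB t x, map_smul], ?_⟩
  obtain ⟨Q, -, hQ⟩ := hBbd.exists_defectLE
  refine ⟨C * Q, fun x y => ?_⟩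
  rw [← map_sub, ← map_sub, mul_assoc]
  exact (hs _ (by simp [hqB])).trans (mul_le_mul_of_nonneg_left (hQ x y) hC)

theorem isBoundedMap_sub_comp [IsQuasinormed X] [IsQuasinormed Y] [IsQuasinormed Z]
    {q : Z →ₗ[ℝ] X} (hq : IsBoundedMap q) {s : Z →ₗ[ℝ] Y} {C : ℝ} (hC : 0 ≤ C)
    (hs : ∀ z, q z = 0 → ‖s z‖ ≤ C * ‖z‖) {B : X → Z} (hqB : ∀ x, q (B x) = x)
    (hB : IsBoundedMap B) {l : X →ₗ[ℝ] Y} (hl : IsBoundedMap fun x => s (B x) - l x) :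
    IsBoundedMap (s - l ∘ₗ q) := by
  have hid : IsBoundedMap (id : Z → Z) := ⟨1, fun z => (one_mul ‖z‖).ge⟩
  obtain ⟨M, hM⟩ := hid.sub (hB.comp hq)
  have hker : IsBoundedMap fun z => s (z - B (q z)) := by
    refine ⟨C * M, fun z => ?_⟩
    rw [mul_assoc]
    exact (hs _ (by simp [hqB])).trans (mul_le_mul_of_nonneg_left (hM z) hC)
  obtain ⟨N, hN⟩ := hker.add (hl.comp hq)
  exact ⟨N, fun z => by simpa using hN z⟩

theorem everyExtensionSplits_of_forall_isTrivialMap [IsQuasiBanach X] [IsQuasiBanach Y]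
    (h : ∀ f : X → Y, IsQuasilinear f → IsTrivialMap f) : EveryExtensionSplits X Y := by
  intro Z _ _ _ _ j q hj hq hinj hexact hsurj
  obtain ⟨C, hC, hqC⟩ := exists_bounded_preimage hq fun _ x _ _ => hsurj x
  obtain ⟨D, hD, hjD⟩ := exists_norm_le_of_injective hj hinj (hexact ▸ isQClosed_ker hq)
  obtain ⟨B, hB, hqB, hBbd⟩ := exists_homogeneous_section hC fun x => hqC x (hsurj x)
  obtain ⟨s, hs⟩ := j.exists_leftInverse_of_injective (LinearMap.ker_eq_bot.2 hinj)
  have hsj (y : Y) : s (j y) = y := LinearMap.congr_fun hs y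
  have hsker (z : Z) (hz : q z = 0) : ‖s z‖ ≤ D * ‖z‖ := by
    obtain ⟨y, rfl⟩ : z ∈ LinearMap.range j := hexact ▸ hz
    exact (hsj y).symm ▸ hjD y
  have hf := isQuasilinear_comp_section hD hsker hB hqB hBbd
  obtain ⟨M, l, hl⟩ := (isTrivialMap_iff_exists_nearLinear hf.1).1 (h _ hf)
  refine ⟨s - l ∘ₗ q, isBoundedMap_sub_comp hq hD hsker hqB hBbd ⟨M, hl⟩, ?_⟩
  ext y
  have hqj : q (j y) = 0 := LinearMap.mem_ker.1 (hexact ▸ LinearMap.mem_range_self j y)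
  simp [hqj, hsj]

end Extensions

section UltrapowerNorm

variable {I : Type w} {U : Ultrafilter I}

theorem exists_tendsto_of_eventually_abs_le {a : I → ℝ} {M : ℝ}
    (h : ∀ᶠ i in (U : Filter I), |a i| ≤ M) : ∃ r, Tendsto a (U : Filter I) (𝓝 r) := by
  have hmem : Set.Icc (-M) M ∈ U.map a := h.mono fun i hi => abs_le.1 hi
  obtain ⟨r, -, hr⟩ := isCompact_Icc.ultrafilter_le_nhds' _ hmem
  exact ⟨r, hr⟩

namespace Ultrapower

variable {X : Type u} [AddCommGroup X] [Module ℝ X] [Norm X] [IsQuasinormed X]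

theorem mk_surjective : Function.Surjective (mk U X) := Submodule.mkQ_surjective _

theorem mk_eq_mk_iff {x y : finiteFamilies U X} :
    mk U X x = mk U X y ↔ Tendsto (fun i => ‖x.1 i - y.1 i‖) (U : Filter I) (𝓝 0) :=
  Submodule.Quotient.eq _

protected theorem norm_nonneg (z : Ultrapower U X) : 0 ≤ ‖z‖ :=
  Real.sInf_nonneg fun _ ⟨_, _, hx⟩ => ge_of_tendsto' hx fun _ => nonneg _

theorem exists_tendsto_norm (x : finiteFamilies U X) :
    ∃ r : ℝ, Tendsto (fun i => ‖x.1 i‖) (U : Filter I) (𝓝 r) := by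
  obtain ⟨M, hM⟩ := x.2
  exact exists_tendsto_of_eventually_abs_le (hM.mono fun i hi => by rwa [abs_of_nonneg (nonneg _)])

theorem norm_mk_le {x : finiteFamilies U X} {M : ℝ} (hM : ∀ᶠ i in (U : Filter I), ‖x.1 i‖ ≤ M) :
    ‖mk U X x‖ ≤ M := by
  obtain ⟨r, hr⟩ := exists_tendsto_norm x
  refine le_trans (csInf_le ⟨0, ?_⟩ ⟨x, rfl, hr⟩) (le_of_tendsto hr hM)
  rintro _ ⟨y, -, hy⟩
  exact ge_of_tendsto' hy fun _ => nonneg _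

theorem exists_mk_eq_of_norm_lt {z : Ultrapower U X} {r : ℝ} (hr : ‖z‖ < r) :
    ∃ x, mk U X x = z ∧ ∀ᶠ i in (U : Filter I), ‖x.1 i‖ < r := by
  obtain ⟨x₀, hx₀⟩ := mk_surjective z
  obtain ⟨r₀, hr₀⟩ := exists_tendsto_norm x₀
  obtain ⟨s, ⟨x, hx, hxs⟩, hsr⟩ := exists_lt_of_csInf_lt
    (s := {r : ℝ | ∃ x, mk U X x = z ∧ Tendsto (fun i => ‖x.1 i‖) (U : Filter I) (𝓝 r)})
    ⟨r₀, x₀, hx₀, hr₀⟩ hr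
  exact ⟨x, hx, hxs.eventually_lt_const hsr⟩

-- The quasinorm of `X` may be discontinuous, so the norms of two representatives need not have
-- the same limit.
theorem eventually_norm_le_of_norm_mk_lt {x : finiteFamilies U X} {r : ℝ} (hr : ‖mk U X x‖ < r) :
    ∀ᶠ i in (U : Filter I), ‖x.1 i‖ ≤ modulus X * (r + 1) := by
  obtain ⟨y, hy, hyr⟩ := exists_mk_eq_of_norm_lt hr
  filter_upwards [hyr, (mk_eq_mk_iff.1 hy.symm).eventually_lt_const one_pos] with i hi hdist
  exact (IsQuasinormed.norm_le_norm_add_norm_sub _ _).trans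
    (mul_le_mul_of_nonneg_left (add_le_add hi.le hdist.le) (modulus_nonneg X))

end Ultrapower

end UltrapowerNorm

section FiniteCharacter

theorem exists_ultrafilter_forall_eventually_mem (α : Type u) :
    ∃ V : Ultrafilter (Finset α), ∀ a, ∀ᶠ s in (V : Filter (Finset α)), a ∈ s := by
  refine ⟨Ultrafilter.of atTop, fun a => Ultrafilter.of_le atTop ?_⟩
  filter_upwards [eventually_ge_atTop ({a} : Finset α)] with s hs
  exact hs (Finset.mem_singleton_self a)

theorem countablyIncomplete_of_forall_eventually_mem {α : Type u} [Infinite α]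
    {V : Ultrafilter (Finset α)} (hV : ∀ a, ∀ᶠ s in (V : Filter (Finset α)), a ∈ s) :
    CountablyIncomplete V := by
  refine ⟨fun n => {s | Infinite.natEmbedding α n ∈ s}, fun n => hV _, ?_⟩
  refine Set.eq_empty_of_forall_notMem fun s hs => ?_
  exact Set.infinite_of_injective_forall_mem (Infinite.natEmbedding α).injective
    (Set.mem_iInter.1 hs) s.finite_toSet

theorem nearLinear_of_eventually {J : Type w} {V : Ultrafilter J} {X : Type u} {Y : Type v}
    [AddCommGroup X] [Module ℝ X] [Norm X] [AddCommGroup Y] [Module ℝ Y] [Norm Y]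
    [IsQuasinormed Y] {P : Ultrapower V Y →ₗ[ℝ] Y} (hPdiag : P ∘ₗ Ultrapower.diag V Y = .id)
    {M : ℝ} (hM : 0 ≤ M) (hP : ∀ z, ‖P z‖ ≤ M * ‖z‖) {f : X → Y} {m : J → X →ₗ[ℝ] Y} {c : ℝ}
    (h : ∀ x, ∀ᶠ j in (V : Filter J), ‖f x - m j x‖ ≤ c * ‖x‖) : NearLinear f (M * c) := by
  let const (y : Y) : finiteFamilies V Y := ⟨fun _ => y, ‖y‖, Eventually.of_forall fun _ => le_rfl⟩
  let error (x : X) : finiteFamilies V Y := ⟨fun j => f x - m j x, _, h x⟩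
  have hfinite (x : X) : LinearMap.pi m x ∈ finiteFamilies V Y := by
    convert sub_mem (const (f x)).2 (error x).2 using 1
    ext j
    simp [const, error]
  let L : X →ₗ[ℝ] finiteFamilies V Y := (LinearMap.pi m).codRestrict _ hfinite
  refine ⟨P ∘ₗ Ultrapower.mk V Y ∘ₗ L, fun x => ?_⟩
  have herror : f x - P (Ultrapower.mk V Y (L x)) = P (Ultrapower.mk V Y (error x)) := by
    have hconst : P (Ultrapower.mk V Y (const (f x))) = f x := LinearMap.congr_fun hPdiag (f x)
    nth_rw 1 [← hconst]
    rw [← map_sub, ← map_sub]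
    rfl
  rw [LinearMap.comp_apply, LinearMap.comp_apply, herror, mul_assoc]
  exact (hP _).trans (mul_le_mul_of_nonneg_left (Ultrapower.norm_mk_le (h x)) hM)

theorem IsUltrasummand.exists_nearLinear_of_finset (X : Type u) {Y : Type u} [AddCommGroup X]
    [Module ℝ X] [Norm X] [AddCommGroup Y] [Module ℝ Y] [Norm Y] [IsQuasinormed Y]
    (hY : IsUltrasummand Y) :
    ∃ D : ℝ, 0 ≤ D ∧ ∀ (f : X → Y) (c : ℝ),
      (∀ s : Finset X, ∃ m : X →ₗ[ℝ] Y, ∀ x ∈ s, ‖f x - m x‖ ≤ c * ‖x‖) →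
        NearLinear f (D * c) := by
  -- The summand `ULift ℕ` makes the index set infinite even when `X` is trivial.
  obtain ⟨V, hV⟩ := exists_ultrafilter_forall_eventually_mem (X ⊕ ULift.{u} ℕ)
  obtain ⟨P, ⟨M, hM⟩, hPdiag⟩ := hY _ V (countablyIncomplete_of_forall_eventually_mem hV)
  refine ⟨max M 0, le_max_right _ _, fun f c h => ?_⟩
  choose m hm using h
  refine nearLinear_of_eventually (m := fun s => m s.toLeft) hPdiag (le_max_right _ _)
    (fun z => ?_) fun x => ?_
  · exact (hM z).trans (mul_le_mul_of_nonneg_right (le_max_left _ _) (Ultrapower.norm_nonneg z))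
  · filter_upwards [hV (Sum.inl x)] with s hs
    exact hm _ _ (Finset.mem_toLeft.2 hs)

end FiniteCharacter

section FiniteSums

variable {X : Type u} {Y : Type v} [AddCommGroup X] [Module ℝ X] [Norm X] [IsQuasinormed X]
  [AddCommGroup Y] [Module ℝ Y] [Norm Y] [IsQuasinormed Y] {ι : Type*}

theorem exists_norm_sum_le (s : Finset ι) :
    ∃ K : ℝ, 0 ≤ K ∧ ∀ x : ι → X, ‖∑ i ∈ s, x i‖ ≤ K * ∑ i ∈ s, ‖x i‖ := by
  classical
  induction s using Finset.induction_on with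
  | empty => exact ⟨0, le_rfl, by simp⟩
  | insert j s hj ih =>
    obtain ⟨K, hK, ih⟩ := ih
    have hΔ := modulus_nonneg X
    refine ⟨modulus X * (1 + K), by positivity, fun x => ?_⟩
    have hsum : 0 ≤ ∑ i ∈ s, ‖x i‖ := Finset.sum_nonneg fun i _ => nonneg (x i)
    have hxj := nonneg (x j)
    rw [Finset.sum_insert hj, Finset.sum_insert hj]
    calc ‖x j + ∑ i ∈ s, x i‖ ≤ modulus X * (‖x j‖ + ‖∑ i ∈ s, x i‖) :=
          IsQuasinormed.norm_add_le _ _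
      _ ≤ modulus X * (‖x j‖ + K * ∑ i ∈ s, ‖x i‖) := by gcongr; exact ih x
      _ ≤ modulus X * ((1 + K) * (‖x j‖ + ∑ i ∈ s, ‖x i‖)) := by gcongr; nlinarith
      _ = modulus X * (1 + K) * (‖x j‖ + ∑ i ∈ s, ‖x i‖) := (mul_assoc _ _ _).symm

theorem exists_norm_map_sum_sub_sum_le (s : Finset ι) :
    ∃ K : ℝ, 0 ≤ K ∧ ∀ (f : X → Y) (Q : ℝ), f 0 = 0 → 0 ≤ Q → DefectLE f Q → ∀ x : ι → X,
      ‖f (∑ i ∈ s, x i) - ∑ i ∈ s, f (x i)‖ ≤ K * Q * ∑ i ∈ s, ‖x i‖ := by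
  classical
  induction s using Finset.induction_on with
  | empty => exact ⟨0, le_rfl, by simp +contextual⟩
  | insert j s hj ih =>
    obtain ⟨K, hK, ih⟩ := ih
    obtain ⟨K', hK', hsum⟩ := exists_norm_sum_le (X := X) s
    have hΔ := modulus_nonneg Y
    refine ⟨modulus Y * (1 + K' + K), by positivity, fun f Q h0 hQ hf x => ?_⟩
    have hx : 0 ≤ ∑ i ∈ s, ‖x i‖ := Finset.sum_nonneg fun i _ => nonneg (x i)
    have hxj := nonneg (x j)
    rw [Finset.sum_insert hj, Finset.sum_insert hj, Finset.sum_insert hj]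
    calc ‖f (x j + ∑ i ∈ s, x i) - (f (x j) + ∑ i ∈ s, f (x i))‖
        = ‖f (x j + ∑ i ∈ s, x i) - f (x j) - f (∑ i ∈ s, x i)
            + (f (∑ i ∈ s, x i) - ∑ i ∈ s, f (x i))‖ := by congr 1; abel
      _ ≤ modulus Y * (Q * (‖x j‖ + ‖∑ i ∈ s, x i‖) + K * Q * ∑ i ∈ s, ‖x i‖) :=
        (IsQuasinormed.norm_add_le _ _).trans <|
          mul_le_mul_of_nonneg_left (add_le_add (hf _ _) (ih f Q h0 hQ hf x)) hΔ
      _ ≤ modulus Y * (Q * (‖x j‖ + K' * ∑ i ∈ s, ‖x i‖) + K * Q * ∑ i ∈ s, ‖x i‖) := by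
        gcongr; exact hsum x
      _ = modulus Y * Q * (‖x j‖ + (K' + K) * ∑ i ∈ s, ‖x i‖) := by ring
      _ ≤ modulus Y * Q * ((1 + K' + K) * (‖x j‖ + ∑ i ∈ s, ‖x i‖)) := by
        gcongr; nlinarith [mul_nonneg (add_nonneg hK' hK) hxj]
      _ = modulus Y * (1 + K' + K) * Q * (‖x j‖ + ∑ i ∈ s, ‖x i‖) := by ring

theorem exists_norm_map_le_of_forall_basis_eq_zero (b : Module.Basis ι ℝ X) (x : X) :
    ∃ K : ℝ, 0 ≤ K ∧ ∀ (f : X → Y) (Q : ℝ), IsHomogeneous f → 0 ≤ Q → DefectLE f Q →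
      (∀ i, f (b i) = 0) → ‖f x‖ ≤ K * Q := by
  let c := b.repr x
  obtain ⟨K, hK, h⟩ := exists_norm_map_sum_sub_sum_le (X := X) (Y := Y) c.support
  have hsum : 0 ≤ ∑ i ∈ c.support, ‖c i • b i‖ := Finset.sum_nonneg fun i _ => nonneg _
  refine ⟨K * ∑ i ∈ c.support, ‖c i • b i‖, mul_nonneg hK hsum, fun f Q hf hQ hd hb => ?_⟩
  have hx : ∑ i ∈ c.support, c i • b i = x := b.linearCombination_repr x
  have hfb (i : ι) : f (c i • b i) = 0 := by rw [hf, hb, smul_zero]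
  have hdefect := h f Q hf.map_zero hQ hd fun i => c i • b i
  simp only [hx, hfb, Finset.sum_const_zero, sub_zero] at hdefect
  exact hdefect.trans_eq (mul_right_comm _ _ _)

theorem sum_abs_mul_le [Fintype ι] (a c : ι → ℝ) (hc : ∀ i, 0 ≤ c i) :
    ∑ i, |a i| * c i ≤ ‖a‖ * ∑ i, c i := by
  rw [Finset.mul_sum]
  exact Finset.sum_le_sum fun i _ => mul_le_mul_of_nonneg_right (norm_le_pi_norm a i) (hc i)

theorem exists_norm_map_sum_smul_le [Fintype ι] {f : X → Y} (hf : IsHomogeneous f) {Q : ℝ}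
    (hQ : 0 ≤ Q) (hd : DefectLE f Q) (v : ι → X) :
    ∃ M : ℝ, 0 ≤ M ∧ ∀ a : ι → ℝ, ‖f (∑ i, a i • v i)‖ ≤ M * ‖a‖ := by
  obtain ⟨K, hK, hdefect⟩ := exists_norm_map_sum_sub_sum_le (X := X) (Y := Y) (Finset.univ (α := ι))
  obtain ⟨K', hK', hsum⟩ := exists_norm_sum_le (X := Y) (Finset.univ (α := ι))
  have hΔ := modulus_nonneg Y
  have hv : 0 ≤ ∑ i, ‖v i‖ := Finset.sum_nonneg fun i _ => nonneg _
  have hfv : 0 ≤ ∑ i, ‖f (v i)‖ := Finset.sum_nonneg fun i _ => nonneg _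
  refine ⟨modulus Y * (K' * ∑ i, ‖f (v i)‖ + K * Q * ∑ i, ‖v i‖), by positivity, fun a => ?_⟩
  have hterms : ‖∑ i, f (a i • v i)‖ ≤ K' * (‖a‖ * ∑ i, ‖f (v i)‖) := by
    refine (hsum _).trans (mul_le_mul_of_nonneg_left ?_ hK')
    simpa only [hf _ _, IsQuasinormed.smul] using sum_abs_mul_le a _ fun i => nonneg (f (v i))
  have herror : ‖f (∑ i, a i • v i) - ∑ i, f (a i • v i)‖ ≤ K * Q * (‖a‖ * ∑ i, ‖v i‖) := by
    refine (hdefect f Q hf.map_zero hQ hd _).trans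
      (mul_le_mul_of_nonneg_left ?_ (mul_nonneg hK hQ))
    simpa only [IsQuasinormed.smul] using sum_abs_mul_le a _ fun i => nonneg (v i)
  calc ‖f (∑ i, a i • v i)‖
      ≤ modulus Y * (‖∑ i, f (a i • v i)‖ + ‖f (∑ i, a i • v i) - ∑ i, f (a i • v i)‖) :=
        IsQuasinormed.norm_le_norm_add_norm_sub _ _
    _ ≤ modulus Y * (K' * (‖a‖ * ∑ i, ‖f (v i)‖) + K * Q * (‖a‖ * ∑ i, ‖v i‖)) :=
        mul_le_mul_of_nonneg_left (add_le_add hterms herror) hΔ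
    _ = modulus Y * (K' * ∑ i, ‖f (v i)‖ + K * Q * ∑ i, ‖v i‖) * ‖a‖ := by ring

end FiniteSums

section FiniteDimensional

theorem defectLE_zero_of_linearMap {X : Type u} {Y : Type v} [AddCommGroup X] [Module ℝ X] [Norm X]
    [AddCommGroup Y] [Module ℝ Y] [Norm Y] [IsQuasinormed Y] (l : X →ₗ[ℝ] Y) : DefectLE l 0 :=
  fun x y => by simp

variable {X : Type u} [AddCommGroup X] [Module ℝ X] [Norm X] [IsQuasinormed X]

theorem exists_norm_le_of_pi {ι : Type*} [Fintype ι] (φ : (ι → ℝ) →ₗ[ℝ] X) :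
    ∃ M : ℝ, 0 ≤ M ∧ ∀ a, ‖φ a‖ ≤ M * ‖a‖ := by
  classical
  obtain ⟨M, hM, h⟩ := exists_norm_map_sum_smul_le (f := LinearMap.id (R := ℝ) (M := X))
    (fun _ _ => rfl) le_rfl (defectLE_zero_of_linearMap _)
    fun i => φ fun j => if i = j then 1 else 0
  refine ⟨M, hM, fun a => ?_⟩
  rw [φ.pi_apply_eq_sum_univ a]
  exact h a

theorem exists_norm_le_of_injective_of_pi {ι : Type*} [Fintype ι] (φ : (ι → ℝ) →ₗ[ℝ] X)
    (hφ : Function.Injective φ) : ∃ c : ℝ, 0 ≤ c ∧ ∀ a, ‖a‖ ≤ c * ‖φ a‖ := by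
  by_contra! h
  have hsphere (n : ℕ) : ∃ a : ι → ℝ, ‖a‖ = 1 ∧ ‖φ a‖ ≤ 1 / ((n : ℝ) + 1) := by
    obtain ⟨a, ha⟩ := h (n + 1) (by positivity)
    have hpos : 0 < ‖a‖ := (mul_nonneg (by positivity) (nonneg (φ a))).trans_lt ha
    refine ⟨‖a‖⁻¹ • a, norm_smul_inv_norm (𝕜 := ℝ) (norm_pos_iff.1 hpos), ?_⟩
    rw [map_smul, IsQuasinormed.smul, abs_of_pos (inv_pos.2 hpos), inv_mul_le_iff₀ hpos,
      mul_one_div, le_div_iff₀ (by positivity), mul_comm]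
    exact ha.le
  choose a ha hφa using hsphere
  obtain ⟨b, hb, ψ, hψ, hlim⟩ :=
    (isCompact_sphere (0 : ι → ℝ) 1).tendsto_subseq fun n => mem_sphere_zero_iff_norm.2 (ha n)
  have hφb : QTendsto (fun n => φ (a (ψ n))) (φ b) :=
    QTendsto.map (tendsto_iff_norm_sub_tendsto_zero.1 hlim) φ
      ((exists_norm_le_of_pi φ).imp fun _ h => h.2)
  have hzero : QTendsto (fun n => φ (a (ψ n))) 0 := by
    refine squeeze_zero (fun _ => nonneg _) (fun n => ?_)
      (tendsto_one_div_add_atTop_nhds_zero_nat.comp hψ.tendsto_atTop)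
    simpa using hφa (ψ n)
  have hb0 : b = 0 := hφ ((hφb.unique hzero).trans (map_zero φ).symm)
  simp [hb0] at hb

theorem DefectLE.exists_norm_le_of_finiteDimensional {Y : Type v} [AddCommGroup Y] [Module ℝ Y]
    [Norm Y] [IsQuasinormed Y] {f : X → Y} {Q : ℝ} (hd : DefectLE f Q) (hQ : 0 ≤ Q)
    (hf : IsHomogeneous f) (E : Submodule ℝ X) [FiniteDimensional ℝ E] :
    ∃ M : ℝ, 0 ≤ M ∧ ∀ x ∈ E, ‖f x‖ ≤ M * ‖x‖ := by
  let b := Module.finBasis ℝ E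
  obtain ⟨c, -, hc⟩ := exists_norm_le_of_injective_of_pi (E.subtype ∘ₗ b.equivFun.symm.toLinearMap)
    (E.injective_subtype.comp b.equivFun.symm.injective)
  obtain ⟨M, hM, hfM⟩ := exists_norm_map_sum_smul_le hf hQ hd fun i => (b i : X)
  refine ⟨M * max c 0, by positivity, fun x hx => ?_⟩
  let a := b.equivFun ⟨x, hx⟩
  have hsum : ∑ i, a i • (b i : X) = x :=
    (map_sum E.subtype _ _).symm.trans (congrArg E.subtype (b.sum_equivFun ⟨x, hx⟩))
  have hnorm : ‖a‖ ≤ max c 0 * ‖x‖ := by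
    refine le_trans ?_ (mul_le_mul_of_nonneg_right (le_max_left _ _) (nonneg x))
    simpa [a] using hc a
  calc ‖f x‖ ≤ M * ‖a‖ := by simpa only [hsum] using hfM a
    _ ≤ M * (max c 0 * ‖x‖) := mul_le_mul_of_nonneg_left hnorm hM
    _ = M * max c 0 * ‖x‖ := (mul_assoc _ _ _).symm

theorem exists_norm_linearMap_le_of_finiteDimensional {Y : Type v} [AddCommGroup Y] [Module ℝ Y]
    [Norm Y] [IsQuasinormed Y] (l : X →ₗ[ℝ] Y) (E : Submodule ℝ X) [FiniteDimensional ℝ E] :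
    ∃ M : ℝ, 0 ≤ M ∧ ∀ x ∈ E, ‖l x‖ ≤ M * ‖x‖ :=
  (defectLE_zero_of_linearMap l).exists_norm_le_of_finiteDimensional le_rfl (map_smul l) E

end FiniteDimensional

section BoundedApproximation

variable {X : Type u} [AddCommGroup X] [Module ℝ X] [Norm X] [IsQuasinormed X]

theorem HasBAP.exists_bounded_projection (h : HasBAP X) (E : Submodule ℝ X)
    [FiniteDimensional ℝ E] : ∃ p : X →ₗ[ℝ] X,
      IsBoundedMap p ∧ (∀ x, p x ∈ E) ∧ ∀ x ∈ E, p x = x := by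
  obtain ⟨c, -, h⟩ := h
  obtain ⟨t, hrange, hbound, happrox⟩ := h E inferInstance (1 / 2) (by norm_num)
  have hinj : LinearMap.ker (t.domRestrict E) = ⊥ := by
    refine LinearMap.ker_eq_bot'.2 fun x hx => Subtype.ext (eq_zero_of_norm_nonpos ?_)
    have hdist := happrox x x.2
    rw [show t x = 0 from hx, zero_sub, IsQuasinormed.norm_neg] at hdist
    linarith
  obtain ⟨π, hπ⟩ := (t.domRestrict E).exists_leftInverse_of_injective hinj
  obtain ⟨M, hM, hπM⟩ :=
    exists_norm_linearMap_le_of_finiteDimensional (E.subtype ∘ₗ π) (LinearMap.range t)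
  refine ⟨E.subtype ∘ₗ π ∘ₗ t, ⟨M * c, fun x => ?_⟩, fun x => (π (t x)).2, fun x hx =>
    congrArg Subtype.val (LinearMap.congr_fun hπ ⟨x, hx⟩)⟩
  rw [mul_assoc]
  exact (hπM (t x) (LinearMap.mem_range_self t x)).trans
    (mul_le_mul_of_nonneg_left (hbound x) hM)

theorem HasBAP.exists_finiteRank_fixing (h : HasBAP X) :
    ∃ c : ℝ, 0 ≤ c ∧ ∀ E : Submodule ℝ X, FiniteDimensional ℝ E →
      ∃ t : X →ₗ[ℝ] X, FiniteDimensional ℝ (LinearMap.range t) ∧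
        (∀ x, ‖t x‖ ≤ c * ‖x‖) ∧ ∀ x ∈ E, t x = x := by
  have hBAP := h
  obtain ⟨c, hc, h⟩ := h
  have hΔ := modulus_nonneg X
  refine ⟨modulus X * (c + 1), by positivity, fun E hE => ?_⟩
  obtain ⟨p, hpbound, hpmem, hpfix⟩ := hBAP.exists_bounded_projection E
  obtain ⟨M, hM, hpM⟩ := hpbound.exists_nonneg
  obtain ⟨t, hrange, hbound, happrox⟩ := h E hE (M + 1)⁻¹ (by positivity)
  -- If `t` is within `1 / (M + 1)` of the identity on `E`, the correction `p - t ∘ p` has norm at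
  -- most one.
  refine ⟨t + (p - t ∘ₗ p), ?_, fun x => ?_, fun x hx => by simp [hpfix x hx]⟩
  · have hle : LinearMap.range (t + (p - t ∘ₗ p)) ≤ LinearMap.range t ⊔ E := by
      rintro _ ⟨x, rfl⟩
      have hsplit : (t + (p - t ∘ₗ p)) x = t (x - p x) + p x := by
        simp only [LinearMap.add_apply, LinearMap.sub_apply, LinearMap.comp_apply, map_sub]
        abel
      rw [hsplit]
      exact Submodule.add_mem_sup (LinearMap.mem_range_self t _) (hpmem x)
    exact Submodule.finiteDimensional_of_le hle
  · have hcorrection : ‖p x - t (p x)‖ ≤ ‖x‖ := by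
      rw [IsQuasinormed.norm_sub_rev]
      refine (happrox _ (hpmem x)).trans ((inv_mul_le_iff₀ (by positivity)).2 ?_)
      linarith [hpM x, nonneg x]
    calc ‖t x + (p x - t (p x))‖ ≤ modulus X * (‖t x‖ + ‖p x - t (p x)‖) :=
          IsQuasinormed.norm_add_le _ _
      _ ≤ modulus X * (c * ‖x‖ + ‖x‖) :=
        mul_le_mul_of_nonneg_left (add_le_add (hbound x) hcorrection) hΔ
      _ = modulus X * (c + 1) * ‖x‖ := by ring

end BoundedApproximation

section KSpace

variable {X : Type u} {Y : Type v} [AddCommGroup X] [Module ℝ X] [Norm X] [IsQuasinormed X]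
  [AddCommGroup Y] [Module ℝ Y] [Norm Y] [IsQuasinormed Y]

theorem IsKSpace.exists_isBoundedMap_functional_sub (hX : IsKSpace X) {g : X → Y}
    (hg : IsQuasilinear g) (R : Submodule ℝ Y) [FiniteDimensional ℝ R] (hgR : ∀ x, g x ∈ R)
    (φ : Y →ₗ[ℝ] ℝ) : ∃ l : X →ₗ[ℝ] ℝ, IsBoundedMap fun x => φ (g x) - l x := by
  obtain ⟨M, hM, hφM⟩ := exists_norm_linearMap_le_of_finiteDimensional φ R
  obtain ⟨Q, -, hQ⟩ := hg.exists_defectLE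
  have hhom : IsHomogeneous fun x => φ (g x) := fun t x => by simp only [hg.1 t x, map_smul]
  have hdefect : DefectLE (fun x => φ (g x)) (M * Q) := fun x y => by
    rw [← map_sub, ← map_sub, mul_assoc]
    exact (hφM _ (sub_mem (sub_mem (hgR _) (hgR _)) (hgR _))).trans
      (mul_le_mul_of_nonneg_left (hQ x y) hM)
  have htrivial := IsQuasilinear.isTrivialMap ⟨hhom, M * Q, hdefect⟩ hX
  obtain ⟨C, l, hl⟩ := (isTrivialMap_iff_exists_nearLinear hhom).1 htrivial
  exact ⟨l, C, hl⟩

theorem IsKSpace.exists_isBoundedMap_sub (hX : IsKSpace X) {g : X → Y} (hg : IsQuasilinear g)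
    (R : Submodule ℝ Y) [FiniteDimensional ℝ R] (hgR : ∀ x, g x ∈ R) :
    ∃ l : X →ₗ[ℝ] Y, IsBoundedMap fun x => g x - l x := by
  let b := Module.finBasis ℝ R
  choose φ hφ using fun i => LinearMap.exists_extend (b.coord i)
  choose l hl using fun i => hX.exists_isBoundedMap_functional_sub hg R hgR (φ i)
  choose N hN hlN using fun i => (hl i).exists_nonneg
  obtain ⟨M, hM, hsum⟩ := exists_norm_le_of_pi (R.subtype ∘ₗ b.equivFun.symm.toLinearMap)
  refine ⟨∑ i, (l i).smulRight (b i : Y), M * ∑ i, N i, fun x => ?_⟩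
  have hgx : g x = ∑ i, φ i (g x) • (b i : Y) := by
    have hcoord (i) : φ i (g x) = b.repr ⟨g x, hgR x⟩ i :=
      LinearMap.congr_fun (hφ i) ⟨g x, hgR x⟩
    simp only [hcoord]
    exact (congrArg R.subtype (b.sum_repr ⟨g x, hgR x⟩)).symm.trans (map_sum R.subtype _ _)
  have hcoords : g x - (∑ i, (l i).smulRight (b i : Y)) x =
      (R.subtype ∘ₗ b.equivFun.symm.toLinearMap) fun i => φ i (g x) - l i x := by
    conv_lhs => rw [hgx]
    simp [Module.Basis.equivFun_symm_apply, sub_smul]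
  have hx := nonneg x
  have hN' : 0 ≤ ∑ i, N i := Finset.sum_nonneg fun i _ => hN i
  beta_reduce
  rw [hcoords, mul_assoc]
  refine (hsum _).trans (mul_le_mul_of_nonneg_left ?_ hM)
  refine (pi_norm_le_iff_of_nonneg (mul_nonneg hN' hx)).2 fun i => (hlN i x).trans ?_
  exact mul_le_mul_of_nonneg_right
    (Finset.single_le_sum (fun i _ => hN i) (Finset.mem_univ i)) hx

end KSpace

section ReductionToBoundedMaps

variable {X Y : Type u} [AddCommGroup X] [Module ℝ X] [Norm X] [IsQuasinormed X]
  [AddCommGroup Y] [Module ℝ Y] [Norm Y] [IsQuasinormed Y]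

theorem UniformlyApproximable.of_domain_hasBAP (hY : IsUltrasummand Y) (hX : HasBAP X)
    (h : UniformlyApproximable (IsBoundedMap : (X → Y) → Prop)) :
    UniformlyApproximable fun _ : X → Y => True := by
  obtain ⟨C, hC, h⟩ := h
  obtain ⟨D, hD, hfinset⟩ := hY.exists_nearLinear_of_finset X
  obtain ⟨c, hc, hfix⟩ := hX.exists_finiteRank_fixing
  refine ⟨D * (C * c), by positivity, fun f hf _ Q hQ hd => ?_⟩
  rw [mul_assoc D, mul_right_comm C, mul_assoc C]
  refine hfinset f _ fun s => ?_
  obtain ⟨t, _, ht, hts⟩ := hfix (Submodule.span ℝ (s : Set X))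
    (FiniteDimensional.span_of_finite ℝ s.finite_toSet)
  obtain ⟨M, hM, hfM⟩ := hd.exists_norm_le_of_finiteDimensional hQ hf (LinearMap.range t)
  have hbounded : IsBoundedMap fun x => f (t x) := ⟨M * c, fun x => by
    rw [mul_assoc]
    exact (hfM _ (LinearMap.mem_range_self t x)).trans (mul_le_mul_of_nonneg_left (ht x) hM)⟩
  have hdefect : DefectLE (fun x => f (t x)) (Q * c) := fun x y => by
    beta_reduce
    rw [map_add t, mul_assoc, mul_add c]
    exact (hd _ _).trans (mul_le_mul_of_nonneg_left (add_le_add (ht x) (ht y)) hQ)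
  obtain ⟨l, hl⟩ := h _ (fun a x => by simp only [map_smul, hf a]) hbounded _ (by positivity)
    hdefect
  refine ⟨l, fun x hx => ?_⟩
  simpa only [hts x (Submodule.subset_span hx)] using hl x

theorem UniformlyApproximable.of_isKSpace_of_codomain_hasBAP (hY : IsUltrasummand Y)
    (hX : IsKSpace X) (hYBAP : HasBAP Y)
    (h : UniformlyApproximable (IsBoundedMap : (X → Y) → Prop)) :
    UniformlyApproximable fun _ : X → Y => True := by
  obtain ⟨C, hC, h⟩ := h
  obtain ⟨D, hD, hfinset⟩ := hY.exists_nearLinear_of_finset X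
  obtain ⟨c, hc, hfix⟩ := hYBAP.exists_finiteRank_fixing
  refine ⟨D * (C * c), by positivity, fun f hf _ Q hQ hd => ?_⟩
  rw [mul_assoc D, mul_assoc C]
  refine hfinset f _ fun s => ?_
  obtain ⟨t, _, ht, hts⟩ := hfix (Submodule.span ℝ (f '' (s : Set X)))
    (FiniteDimensional.span_of_finite ℝ (s.finite_toSet.image f))
  have hhom : IsHomogeneous fun x => t (f x) := fun a x => by simp only [hf a, map_smul]
  have hdefect : DefectLE (fun x => t (f x)) (c * Q) := hd.linearMap_comp hc ht
  obtain ⟨k, hk⟩ := hX.exists_isBoundedMap_sub ⟨hhom, c * Q, hdefect⟩ (LinearMap.range t)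
    fun x => LinearMap.mem_range_self t (f x)
  obtain ⟨l, hl⟩ := (h _ (hhom.sub_linearMap k) hk _ (by positivity)
    (hdefect.sub_linearMap k)).of_sub_linearMap k
  refine ⟨l, fun x hx => ?_⟩
  simpa only [hts (f x) (Submodule.subset_span ⟨x, hx, rfl⟩)] using hl x

theorem approxK_lt_top_of_approxK₀_lt_top (hY : IsUltrasummand Y)
    (hXY : HasBAP X ∨ (IsKSpace X ∧ HasBAP Y)) (h : approxK₀ X Y < ⊤) : approxK X Y < ⊤ := by
  rw [approxK₀_lt_top_iff] at h
  rw [approxK_lt_top_iff]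
  rcases hXY with hX | ⟨hX, hYBAP⟩
  · exact .of_domain_hasBAP hY hX h
  · exact .of_isKSpace_of_codomain_hasBAP hY hX hYBAP h

end ReductionToBoundedMaps

section UniformBoundedness

theorem exists_forall_basis_eq_zero_not_nearLinear {X : Type u} {Y : Type v} [AddCommGroup X]
    [Module ℝ X] [Norm X] [IsQuasinormed X] [AddCommGroup Y] [Module ℝ Y] [Norm Y]
    [IsQuasinormed Y] {ι : Type*} (b : Module.Basis ι ℝ X)
    (h : ¬ UniformlyApproximable fun _ : X → Y => True) {δ : ℝ} (hδ : 0 < δ) (C : ℝ) :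
    ∃ f : X → Y, IsHomogeneous f ∧ DefectLE f δ ∧ (∀ i, f (b i) = 0) ∧ ¬ NearLinear f C := by
  obtain ⟨f, hf, -, hd, hfar⟩ := exists_defectLE_not_nearLinear (fun _ _ h => h) h hδ C
  let l : X →ₗ[ℝ] Y := b.constr ℝ fun i => f (b i)
  refine ⟨fun x => f x - l x, hf.sub_linearMap l, hd.sub_linearMap l, fun i => ?_,
    fun hnear => hfar (hnear.of_sub_linearMap l)⟩
  simp [l, b.constr_basis]

theorem isQuasilinear_of_qTendsto_sum {X : Type u} {Y : Type v} [AddCommGroup X] [Module ℝ X]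
    [Norm X] [AddCommGroup Y] [Module ℝ Y] [Norm Y] [IsQuasinormed Y]
    {g : ℕ → X → Y} (hg : ∀ k, IsHomogeneous (g k)) (hd : ∀ k, DefectLE (g k) (ratio Y ^ k))
    {s : X → Y} (hs : ∀ x, QTendsto (fun n => ∑ k ∈ Finset.range n, g k x) (s x)) :
    IsQuasilinear s := by
  refine ⟨fun t x => (hs (t • x)).unique ?_, modulus Y * (2 * modulus Y), fun x y => ?_⟩
  · simpa only [Finset.smul_sum, hg _ t x] using (hs x).smul t
  · rw [mul_assoc]
    refine (((hs (x + y)).sub (hs x)).sub (hs y)).norm_le (Eventually.of_forall fun n => ?_)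
    rw [← Finset.sum_sub_distrib, ← Finset.sum_sub_distrib]
    refine norm_sum_range_le_of_geometric n fun k => ?_
    rw [mul_comm]
    exact hd k x y

variable {X Y : Type u} [AddCommGroup X] [Module ℝ X] [Norm X] [IsQuasinormed X]
  [AddCommGroup Y] [Module ℝ Y] [Norm Y] [IsQuasiBanach Y]

theorem exists_forall_finset_exists_linearMap {g : ℕ → X → Y} (hg : ∀ k, IsHomogeneous (g k))
    (hd : ∀ k, DefectLE (g k) (ratio Y ^ k)) {K : X → ℝ}
    (hK : ∀ k x, ‖g k x‖ ≤ K x * ratio Y ^ k)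
    (h : ∀ f : X → Y, IsQuasilinear f → IsTrivialMap f) :
    ∃ (c : ℝ) (n₀ : ℕ), ∀ n, n₀ ≤ n → ∀ F : Finset X,
      ∃ m : X →ₗ[ℝ] Y, ∀ x ∈ F, ‖g n x - m x‖ ≤ c * ‖x‖ := by
  classical
  have hsub (S : Set ℕ) (s : X → Y)
      (hs : ∀ x, QTendsto (fun n => ∑ k ∈ Finset.range n, S.indicator (g · x) k) (s x)) :
      ∃ N : ℕ, NearLinear s N := by
    have hquasi : IsQuasilinear s := by
      refine isQuasilinear_of_qTendsto_sum (fun k t x => ?_) (fun k x y => ?_) hs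
      · by_cases hk : k ∈ S <;> simp [hk, hg k t x]
      · have hnonneg : 0 ≤ ratio Y ^ k * (‖x‖ + ‖y‖) :=
          mul_nonneg (pow_pos (ratio_pos Y) k).le (add_nonneg (nonneg x) (nonneg y))
        by_cases hk : k ∈ S <;> simp [hk, hd k x y, hnonneg]
    obtain ⟨C, hC⟩ := (isTrivialMap_iff_exists_nearLinear hquasi.1).1 (h s hquasi)
    exact (exists_nat_ge C).imp fun N hN => hC.mono hN
  obtain ⟨N, n₀, hN⟩ := exists_forall_norm_sub_sub_le_of_subseries
    (A := fun N => {s | NearLinear s N}) hK hsub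
  refine ⟨modulus Y * (1 + modulus Y * (N + N)), n₀, fun n hn F => ?_⟩
  obtain ⟨s, ⟨l, hl⟩, s', ⟨l', hl'⟩, hgs⟩ := hN n hn (F.erase 0) (fun x => ‖x‖)
    fun x hx => IsQuasinormed.norm_pos (Finset.ne_of_mem_erase hx)
  refine ⟨l - l', fun x hx => ?_⟩
  obtain rfl | hx0 := eq_or_ne x 0
  · simp [(hg n).map_zero]
  · have hΔ := modulus_nonneg Y
    have hdist : ‖s x - s' x - (l - l') x‖ ≤ modulus Y * (N * ‖x‖ + N * ‖x‖) := by
      rw [LinearMap.sub_apply, sub_sub_sub_comm]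
      exact (IsQuasinormed.norm_sub_le _ _).trans
        (mul_le_mul_of_nonneg_left (add_le_add (hl x) (hl' x)) hΔ)
    calc ‖g n x - (l - l') x‖
        ≤ modulus Y * (‖g n x - (s x - s' x)‖ + ‖s x - s' x - (l - l') x‖) :=
          IsQuasinormed.norm_sub_le_norm_sub_add_norm_sub _ _ _
      _ ≤ modulus Y * (‖x‖ + modulus Y * (N * ‖x‖ + N * ‖x‖)) := mul_le_mul_of_nonneg_left
          (add_le_add (hgs x (Finset.mem_erase.2 ⟨hx0, hx⟩)) hdist) hΔ
      _ = modulus Y * (1 + modulus Y * (N + N)) * ‖x‖ := by ring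

theorem approxK_lt_top_of_forall_isTrivialMap (hY : IsUltrasummand Y)
    (h : ∀ f : X → Y, IsQuasilinear f → IsTrivialMap f) : approxK X Y < ⊤ := by
  rw [approxK_lt_top_iff]
  by_contra hfar
  let b := Module.Basis.ofVectorSpace ℝ X
  choose g hg hd hgb hgfar using fun n : ℕ =>
    exists_forall_basis_eq_zero_not_nearLinear b hfar (pow_pos (ratio_pos Y) n) n
  choose K _ hK using fun x => exists_norm_map_le_of_forall_basis_eq_zero (Y := Y) b x
  obtain ⟨c, n₀, hc⟩ := exists_forall_finset_exists_linearMap hg hd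
    (fun k x => hK x (g k) _ (hg k) (pow_pos (ratio_pos Y) k).le (hd k) (hgb k)) h
  obtain ⟨D, -, hfinset⟩ := hY.exists_nearLinear_of_finset X
  obtain ⟨n₁, hn₁⟩ := exists_nat_ge (D * c)
  refine hgfar (max n₀ n₁) ((hfinset _ c (hc _ (le_max_left _ _))).mono (hn₁.trans ?_))
  exact_mod_cast le_max_right n₀ n₁

end UniformBoundedness

section Families

theorem eventually_forall_mem_of_forall_selection {α β : Type*} {l : Filter α} {s : Set β}
    (hs : s.Nonempty) {p : α → β → Prop}
    (h : ∀ x : α → β, (∀ i, x i ∈ s) → ∀ᶠ i in l, p i (x i)) : ∀ᶠ i in l, ∀ b ∈ s, p i b := by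
  have hworst (i : α) : ∃ b ∈ s, p i b → ∀ b ∈ s, p i b := by
    by_cases hi : ∀ b ∈ s, p i b
    · exact ⟨hs.some, hs.some_mem, fun _ => hi⟩
    · push Not at hi
      obtain ⟨b, hb, hpb⟩ := hi
      exact ⟨b, hb, fun h => absurd h hpb⟩
  choose x hxs hx using hworst
  exact (h x hxs).mono hx

theorem CountablyIncomplete.exists_tendsto_atTop {I : Type w} {U : Ultrafilter I}
    (hU : CountablyIncomplete U) : ∃ ν : I → ℕ, Tendsto ν (U : Filter I) atTop := by
  classical
  obtain ⟨S, hS, hSempty⟩ := hU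
  have hescape (i : I) : ∃ k, i ∉ S k := by
    simpa using (Set.eq_empty_iff_forall_notMem.1 hSempty) i
  refine ⟨fun i => Nat.find (hescape i), tendsto_atTop.2 fun k => ?_⟩
  filter_upwards [(eventually_all_finset (Finset.range k)).2 fun j _ => hS j] with i hi
  exact (Nat.le_find_iff _ _).2 fun m hm => not_not.2 (hi m (Finset.mem_range.2 hm))

variable {I : Type w} {U : Ultrafilter I} {X : Type u} [AddCommGroup X] [Module ℝ X] [Norm X]
  [IsQuasinormed X]

theorem infinitesimalFamilies_le_finiteFamilies :
    infinitesimalFamilies U X ≤ finiteFamilies U X := fun _ hx =>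
  ⟨1, (Tendsto.eventually_lt_const one_pos hx).mono fun _ hi => hi.le⟩

theorem mem_finiteFamilies_of_tendsto_norm_sub (x : finiteFamilies U X) {y : I → X}
    (h : Tendsto (fun i => ‖x.1 i - y i‖) (U : Filter I) (𝓝 0)) : y ∈ finiteFamilies U X := by
  have hsub : x.1 - y ∈ finiteFamilies U X := infinitesimalFamilies_le_finiteFamilies h
  simpa using sub_mem x.2 hsub

theorem tendsto_mul_norm {a : I → ℝ} (ha : Tendsto a (U : Filter I) (𝓝 0))
    (x : finiteFamilies U X) : Tendsto (fun i => a i * ‖x.1 i‖) (U : Filter I) (𝓝 0) := by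
  obtain ⟨r, hr⟩ := Ultrapower.exists_tendsto_norm x
  simpa using ha.mul hr

theorem tendsto_norm_smul_sub_smul {a : I → ℝ} {t : ℝ} (ha : Tendsto a (U : Filter I) (𝓝 t))
    (x : finiteFamilies U X) :
    Tendsto (fun i => ‖(t • x).1 i - a i • x.1 i‖) (U : Filter I) (𝓝 0) := by
  have hdiff : Tendsto (fun i => |t - a i|) (U : Filter I) (𝓝 0) := by
    simpa using (ha.const_sub t).abs
  refine (tendsto_mul_norm hdiff x).congr fun i => ?_
  rw [← IsQuasinormed.smul, sub_smul]
  rfl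

end Families

section AccessibleOperators

variable {I : Type w} {U : Ultrafilter I} {X : Type u} {Y : Type v}
  [AddCommGroup X] [Module ℝ X] [Norm X] [IsQuasinormed X]
  [AddCommGroup Y] [Module ℝ Y] [Norm Y] [IsQuasinormed Y]

theorem IsHomogeneous.defectLE_of_unitBall {f : X → Y} (hf : IsHomogeneous f) {Q : ℝ}
    (h : ∀ x y, ‖x‖ ≤ 1 → ‖y‖ ≤ 1 → ‖f (x + y) - f x - f y‖ ≤ Q) : DefectLE f Q := fun x y => by
  have hx := nonneg x
  have hy := nonneg y
  obtain hzero | hpos := (add_nonneg hx hy).eq_or_lt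
  · obtain rfl : x = 0 := eq_zero_of_norm_nonpos (by linarith)
    obtain rfl : y = 0 := eq_zero_of_norm_nonpos (by linarith)
    simp [hf.map_zero]
  · have hscale (z : X) (hz : ‖z‖ ≤ ‖x‖ + ‖y‖) : ‖(‖x‖ + ‖y‖)⁻¹ • z‖ ≤ 1 := by
      rwa [IsQuasinormed.smul, abs_of_pos (inv_pos.2 hpos), inv_mul_le_one₀ hpos]
    have hball := h _ _ (hscale x (by linarith)) (hscale y (by linarith))
    rwa [← smul_add, hf, hf, hf, ← smul_sub, ← smul_sub, IsQuasinormed.smul,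
      abs_of_pos (inv_pos.2 hpos), inv_mul_le_iff₀ hpos, mul_comm] at hball

namespace IsInducedBy

theorem eventually_norm_sub_le {F : Ultrapower U X → Ultrapower U Y} {f g : I → X → Y}
    (hf : IsInducedBy F f) (hg : IsInducedBy F g) {ε : ℝ} (hε : 0 < ε) :
    ∀ᶠ i in (U : Filter I), ∀ x ∈ {x | ‖x‖ ≤ 1}, ‖f i x - g i x‖ ≤ ε := by
  refine eventually_forall_mem_of_forall_selection ⟨0, by simp⟩ fun x hx => ?_
  obtain ⟨_, hFf⟩ := hf ⟨x, 1, .of_forall hx⟩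
  obtain ⟨_, hFg⟩ := hg ⟨x, 1, .of_forall hx⟩
  exact ((Ultrapower.mk_eq_mk_iff.1 (hFf.symm.trans hFg)).eventually_lt_const hε).mono
    fun _ hi => hi.le

theorem congr_of_eventually_norm_sub_le {F : Ultrapower U X → Ultrapower U Y} {f g : I → X → Y}
    (hf : IsInducedBy F f)
    (h : ∀ ε : ℝ, 0 < ε → ∀ᶠ i in (U : Filter I), ∀ x, ‖f i x - g i x‖ ≤ ε * ‖x‖) :
    IsInducedBy F g := fun x => by
  obtain ⟨hfx, hF⟩ := hf x
  have hlim : Tendsto (fun i => ‖f i (x.1 i) - g i (x.1 i)‖) (U : Filter I) (𝓝 0) := by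
    obtain ⟨r, hr⟩ := Ultrapower.exists_tendsto_norm x
    have hr0 : 0 ≤ r := ge_of_tendsto' hr fun _ => nonneg _
    refine tendsto_order.2 ⟨fun a ha => .of_forall fun i => ha.trans_le (nonneg _), fun a ha => ?_⟩
    filter_upwards [h (a / (r + 1)) (by positivity), hr.eventually_lt_const (lt_add_one r)]
      with i hi hir
    calc ‖f i (x.1 i) - g i (x.1 i)‖ ≤ a / (r + 1) * ‖x.1 i‖ := hi _
      _ < a / (r + 1) * (r + 1) := by gcongr
      _ = a := div_mul_cancel₀ _ (by positivity)
  exact ⟨mem_finiteFamilies_of_tendsto_norm_sub ⟨_, hfx⟩ hlim,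
    hF.trans (Ultrapower.mk_eq_mk_iff.2 hlim)⟩

theorem homogenize {T : Ultrapower U X →ₗ[ℝ] Ultrapower U Y} {f : I → X → Y}
    (hf : IsInducedBy T f) : IsInducedBy T fun i => _root_.homogenize (f i) := fun x => by
  let unit : finiteFamilies U X :=
    ⟨fun i => lineUnit (x.1 i), 1, .of_forall fun i => norm_lineUnit_le_one _⟩
  obtain ⟨hfunit, hTunit⟩ := hf unit
  obtain ⟨M, hM⟩ := x.2
  obtain ⟨t, ht⟩ := exists_tendsto_of_eventually_abs_le (U := U)
    (a := fun i => lineCoord (x.1 i)) (hM.mono fun i hi => (abs_lineCoord _).trans_le hi)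
  have hx : Ultrapower.mk U X x = t • Ultrapower.mk U X unit := by
    rw [← map_smul, eq_comm, Ultrapower.mk_eq_mk_iff]
    refine (tendsto_norm_smul_sub_smul ht unit).congr fun i => ?_
    rw [show lineCoord (x.1 i) • unit.1 i = x.1 i from lineCoord_smul_lineUnit _]
  have hlim := tendsto_norm_smul_sub_smul ht ⟨_, hfunit⟩
  refine ⟨mem_finiteFamilies_of_tendsto_norm_sub _ hlim, ?_⟩
  rw [hx, map_smul, hTunit, ← map_smul]
  exact Ultrapower.mk_eq_mk_iff.2 hlim

variable {T : Ultrapower U X →ₗ[ℝ] Ultrapower U Y} {g : I → X → Y}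

theorem exists_eventually_norm_le (hTg : IsInducedBy T g) (hT : IsBoundedMap T)
    (hg : ∀ i, IsHomogeneous (g i)) :
    ∃ M : ℝ, ∀ᶠ i in (U : Filter I), ∀ x, ‖g i x‖ ≤ M * ‖x‖ := by
  obtain ⟨N, hN⟩ := hT
  set M := modulus Y * (max N 0 + 1 + 1)
  have hball : ∀ᶠ i in (U : Filter I), ∀ x ∈ {x | ‖x‖ ≤ 1}, ‖g i x‖ ≤ M := by
    refine eventually_forall_mem_of_forall_selection ⟨0, by simp⟩ fun x hx => ?_
    obtain ⟨hgx, hTx⟩ := hTg ⟨x, 1, .of_forall hx⟩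
    refine Ultrapower.eventually_norm_le_of_norm_mk_lt (x := ⟨_, hgx⟩) ?_
    rw [← hTx]
    refine lt_of_le_of_lt ?_ (lt_add_one _)
    calc ‖T (Ultrapower.mk U X ⟨x, 1, .of_forall hx⟩)‖
      _ ≤ N * ‖Ultrapower.mk U X ⟨x, 1, .of_forall hx⟩‖ := hN _
      _ ≤ max N 0 * 1 :=
          mul_le_mul (le_max_left _ _) (Ultrapower.norm_mk_le (.of_forall hx))
            (Ultrapower.norm_nonneg _) (le_max_right _ _)
      _ = max N 0 := mul_one _
  exact ⟨M, hball.mono fun i hi => (hg i).norm_le_of_sphere fun x hx => hi x hx.le⟩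

theorem eventually_defectLE (hTg : IsInducedBy T g) (hg : ∀ i, IsHomogeneous (g i)) {ε : ℝ}
    (hε : 0 < ε) : ∀ᶠ i in (U : Filter I), DefectLE (g i) ε := by
  have hball : ∀ᶠ i in (U : Filter I), ∀ z ∈ {z : X × X | ‖z.1‖ ≤ 1 ∧ ‖z.2‖ ≤ 1},
      ‖g i (z.1 + z.2) - g i z.1 - g i z.2‖ ≤ ε := by
    refine eventually_forall_mem_of_forall_selection ⟨0, by simp⟩ fun z hz => ?_
    let x : finiteFamilies U X := ⟨fun i => (z i).1, 1, .of_forall fun i => (hz i).1⟩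
    let y : finiteFamilies U X := ⟨fun i => (z i).2, 1, .of_forall fun i => (hz i).2⟩
    obtain ⟨_, hTx⟩ := hTg x
    obtain ⟨_, hTy⟩ := hTg y
    obtain ⟨_, hTxy⟩ := hTg (x + y)
    rw [map_add, map_add, hTx, hTy, ← map_add, eq_comm, Ultrapower.mk_eq_mk_iff] at hTxy
    filter_upwards [hTxy.eventually_lt_const hε] with i hi
    rw [sub_sub]
    exact hi.le
  exact hball.mono fun i hi => (hg i).defectLE_of_unitBall fun x y hx hy => hi (x, y) ⟨hx, hy⟩

end IsInducedBy

theorem UniformlyApproximable.exists_operator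
    (h : UniformlyApproximable (IsBoundedMap : (X → Y) → Prop)) :
    ∃ C : ℝ, 0 ≤ C ∧ ∀ f : X → Y, IsHomogeneous f → IsBoundedMap f →
      ∃ t : X →ₗ[ℝ] Y, IsBoundedMap t ∧
        ∀ Q : ℝ, 0 ≤ Q → DefectLE f Q → ∀ x, ‖f x - t x‖ ≤ C * Q * ‖x‖ := by
  obtain ⟨C, hC, h⟩ := h
  refine ⟨C, hC, fun f hf hb => ?_⟩
  have hquasilinear : IsQuasilinear f := ⟨hf, hb.exists_defectLE.imp fun _ => And.right⟩
  obtain ⟨t, ht⟩ := h f hf hb _ ENNReal.toReal_nonneg hquasilinear.defectLE_quasilinConst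
  refine ⟨t, ?_, fun Q hQ hd x => (ht x).trans ?_⟩
  · simpa using hb.sub (g := fun x => f x - t x) ⟨_, ht⟩
  · exact mul_le_mul_of_nonneg_right (mul_le_mul_of_nonneg_left
      (ENNReal.toReal_le_of_le_ofReal hQ (hd.quasilinConst_le hQ)) hC) (nonneg x)

theorem isUltraproductOfOperators_of_approxK₀_lt_top (h : approxK₀ X Y < ⊤)
    (T : Ultrapower U X →ₗ[ℝ] Ultrapower U Y) (hT : IsBoundedMap T) (hTacc : IsAccessible T) :
    IsUltraproductOfOperators T := by
  obtain ⟨f, hTf⟩ := hTacc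
  have hg (i : I) : IsHomogeneous (homogenize (f i)) := isHomogeneous_homogenize (f i)
  obtain ⟨M, hM⟩ := hTf.homogenize.exists_eventually_norm_le hT hg
  obtain ⟨C, hC, happrox⟩ := (approxK₀_lt_top_iff.1 h).exists_operator
  have hoperator (i : I) : ∃ t : X →ₗ[ℝ] Y, IsBoundedMap t ∧
      (IsBoundedMap (homogenize (f i)) → ∀ Q : ℝ, 0 ≤ Q → DefectLE (homogenize (f i)) Q →
        ∀ x, ‖homogenize (f i) x - t x‖ ≤ C * Q * ‖x‖) := by
    by_cases hb : IsBoundedMap (homogenize (f i))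
    · exact (happrox _ (hg i) hb).imp fun t ht => ⟨ht.1, fun _ => ht.2⟩
    · exact ⟨0, ⟨0, by simp⟩, fun h => absurd h hb⟩
  choose t htb ht using hoperator
  refine ⟨t, htb, hTf.homogenize.congr_of_eventually_norm_sub_le fun ε hε => ?_⟩
  have hδ : 0 < ε / (C + 1) := by positivity
  filter_upwards [hTf.homogenize.eventually_defectLE hg hδ, hM] with i hi hMi x
  refine (ht i ⟨M, hMi⟩ _ hδ.le hi x).trans (mul_le_mul_of_nonneg_right ?_ (nonneg x))
  calc C * (ε / (C + 1)) ≤ (C + 1) * (ε / (C + 1)) := by gcongr; linarith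
    _ = ε := mul_div_cancel₀ _ (by positivity)

end AccessibleOperators

section NonapproximableMaps

variable {I : Type w} {U : Ultrafilter I} {X : Type u} {Y : Type v}
  [AddCommGroup X] [Module ℝ X] [Norm X] [IsQuasinormed X]
  [AddCommGroup Y] [Module ℝ Y] [Norm Y] [IsQuasinormed Y]

-- Rescale `f - l`, where the linear map `l` is within a factor 2 of being nearest to `f`.
theorem NearLinear.exists_norm_le_not_nearLinear_half {f : X → Y} {B C Q : ℝ}
    (hB : NearLinear f B) (hf : IsHomogeneous f) (hQ : 0 ≤ Q) (hd : DefectLE f Q) (hC : 0 < C)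
    (hfar : ¬ NearLinear f C) :
    ∃ g : X → Y, IsHomogeneous g ∧ DefectLE g (Q / C) ∧ (∀ x, ‖g x‖ ≤ ‖x‖) ∧
      ¬ NearLinear g (1 / 2) := by
  let distances : Set ℝ := {M | NearLinear f M}
  have hlower : ∀ M ∈ distances, C ≤ M := fun M hM => by
    by_contra! hlt
    exact hfar (hM.mono hlt.le)
  have hinf : C ≤ sInf distances := le_csInf ⟨B, hB⟩ hlower
  obtain ⟨M, hM, hM2⟩ := exists_lt_of_csInf_lt ⟨B, hB⟩
    (show sInf distances < 2 * sInf distances by linarith)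
  have hCM := hlower M hM
  have hM0 : 0 < M := hC.trans_le hCM
  obtain ⟨l, hl⟩ := hM
  refine ⟨fun x => M⁻¹ • (f x - l x), (hf.sub_linearMap l).const_smul _, ?_, fun x => ?_,
    fun hnear => ?_⟩
  · refine ((hd.sub_linearMap l).const_smul M⁻¹).mono ?_
    rw [abs_of_pos (inv_pos.2 hM0), inv_mul_eq_div]
    exact div_le_div_of_nonneg_left hQ hC hCM
  · rw [IsQuasinormed.smul, abs_of_pos (inv_pos.2 hM0), inv_mul_le_iff₀ hM0]
    exact hl x
  · have hcloser : NearLinear f (M * (1 / 2)) := .of_sub_linearMap l <| by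
      simpa [smul_smul, abs_of_pos hM0, hM0.ne'] using hnear.const_smul M
    have := csInf_le ⟨C, hlower⟩ hcloser
    linarith

section AsymptoticallyLinear

variable {G : I → X → Y} {M : ℝ}

theorem mem_finiteFamilies_of_norm_le (hM0 : 0 ≤ M) (hM : ∀ i x, ‖G i x‖ ≤ M * ‖x‖)
    (x : finiteFamilies U X) : (fun i => G i (x.1 i)) ∈ finiteFamilies U Y := by
  obtain ⟨N, hN⟩ := x.2
  exact ⟨M * N, hN.mono fun i hi => (hM i _).trans (mul_le_mul_of_nonneg_left hi hM0)⟩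

theorem exists_linearMap_mk_of_asymptotically_linear {ε : I → ℝ} (hG : ∀ i, IsHomogeneous (G i))
    (hfin : ∀ x : finiteFamilies U X, (fun i => G i (x.1 i)) ∈ finiteFamilies U Y)
    (hε : Tendsto ε (U : Filter I) (𝓝 0)) (hd : ∀ i, DefectLE (G i) (ε i)) :
    ∃ L : finiteFamilies U X →ₗ[ℝ] Ultrapower U Y,
      ∀ x, L x = Ultrapower.mk U Y ⟨fun i => G i (x.1 i), hfin x⟩ := by
  refine ⟨{ toFun x := Ultrapower.mk U Y ⟨fun i => G i (x.1 i), hfin x⟩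
            map_add' x y := ?_
            map_smul' t x := ?_ }, fun _ => rfl⟩
  · rw [← map_add, Ultrapower.mk_eq_mk_iff]
    have hlim := (tendsto_mul_norm hε x).add (tendsto_mul_norm hε y)
    rw [add_zero] at hlim
    refine squeeze_zero (fun _ => nonneg _) (fun i => ?_) hlim
    have := hd i (x.1 i) (y.1 i)
    rwa [sub_sub, mul_add] at this
  · rw [RingHom.id_apply, ← map_smul]
    exact congrArg _ (Subtype.ext (funext fun i => hG i t (x.1 i)))

theorem exists_operator_isInducedBy_of_asymptotically_linear {ε : I → ℝ}
    (hG : ∀ i, IsHomogeneous (G i)) (hM0 : 0 ≤ M) (hM : ∀ i x, ‖G i x‖ ≤ M * ‖x‖)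
    (hε : Tendsto ε (U : Filter I) (𝓝 0)) (hd : ∀ i, DefectLE (G i) (ε i)) :
    ∃ T : Ultrapower U X →ₗ[ℝ] Ultrapower U Y, IsBoundedMap T ∧ IsInducedBy T G := by
  have hfin := mem_finiteFamilies_of_norm_le (U := U) hM0 hM
  obtain ⟨L, hL⟩ := exists_linearMap_mk_of_asymptotically_linear hG hfin hε hd
  have hker : (infinitesimalFamilies U X).submoduleOf (finiteFamilies U X) ≤
      LinearMap.ker L := fun x hx => by
    have hx' : Tendsto (fun i => ‖x.1 i‖) (U : Filter I) (𝓝 0) := hx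
    rw [LinearMap.mem_ker, hL, ← map_zero (Ultrapower.mk U Y), Ultrapower.mk_eq_mk_iff]
    refine squeeze_zero (fun _ => nonneg _) (fun i => ?_) (by simpa using hx'.const_mul M)
    simpa using hM i (x.1 i)
  let T : Ultrapower U X →ₗ[ℝ] Ultrapower U Y := Submodule.liftQ _ L hker
  have hT (x : finiteFamilies U X) : T (Ultrapower.mk U X x) =
      Ultrapower.mk U Y ⟨fun i => G i (x.1 i), hfin x⟩ := (Submodule.liftQ_apply _ L x).trans (hL x)
  refine ⟨T, ⟨M, fun z => ?_⟩, fun x => ⟨hfin x, hT x⟩⟩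
  have hlim : Tendsto (fun r : ℝ => M * r) (𝓝[>] ‖z‖) (𝓝 (M * ‖z‖)) :=
    (tendsto_nhdsWithin_of_tendsto_nhds tendsto_id).const_mul M
  refine ge_of_tendsto hlim (eventually_nhdsWithin_of_forall fun r hr => ?_)
  obtain ⟨x, rfl, hx⟩ := Ultrapower.exists_mk_eq_of_norm_lt hr
  rw [hT]
  exact Ultrapower.norm_mk_le
    (hx.mono fun i hi => (hM i _).trans (mul_le_mul_of_nonneg_left hi.le hM0))

end AsymptoticallyLinear

theorem approxK₀_lt_top_of_forall_isUltraproductOfOperators (hU : CountablyIncomplete U)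
    (h : ∀ T : Ultrapower U X →ₗ[ℝ] Ultrapower U Y, IsBoundedMap T → IsAccessible T →
      IsUltraproductOfOperators T) : approxK₀ X Y < ⊤ := by
  rw [approxK₀_lt_top_iff]
  by_contra hnot
  have hfar (n : ℕ) : ∃ g : X → Y, IsHomogeneous g ∧ DefectLE g (1 / (n + 1)) ∧
      (∀ x, ‖g x‖ ≤ ‖x‖) ∧ ¬ NearLinear g (1 / 2) := by
    obtain ⟨f, hf, ⟨B, hB⟩, hd, hnear⟩ := exists_defectLE_not_nearLinear
      (fun c _ hf => hf.const_smul c) hnot one_pos (n + 1 : ℝ)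
    have hBnear : NearLinear f B := ⟨0, by simpa using hB⟩
    exact hBnear.exists_norm_le_not_nearLinear_half hf zero_le_one hd (by positivity) hnear
  choose g hg hgd hgb hgfar using hfar
  obtain ⟨ν, hν⟩ := hU.exists_tendsto_atTop
  obtain ⟨T, hTb, hTg⟩ := exists_operator_isInducedBy_of_asymptotically_linear (U := U)
    (G := fun i => g (ν i)) (fun i => hg _) zero_le_one (fun i x => by simpa using hgb _ x)
    (tendsto_one_div_add_atTop_nhds_zero_nat.comp hν) fun i => hgd _
  obtain ⟨t, -, hTt⟩ := h T hTb ⟨_, hTg⟩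
  obtain ⟨i, hi⟩ := (hTg.eventually_norm_sub_le hTt one_half_pos).exists
  exact hgfar (ν i) ⟨t i, ((hg _).sub_linearMap (t i)).norm_le_of_sphere fun x hx => hi x hx.le⟩

end NonapproximableMaps

theorem mainTheorem5 {I : Type w} (U : Ultrafilter I) (hU : CountablyIncomplete U)
    (X Y : Type u) [AddCommGroup X] [Module ℝ X] [Norm X] [IsQuasiBanach X]
    [AddCommGroup Y] [Module ℝ Y] [Norm Y] [IsQuasiBanach Y]
    (hY : IsUltrasummand Y) (hXY : HasBAP X ∨ (IsKSpace X ∧ HasBAP Y)) :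
    List.TFAE [
      ∀ T : Ultrapower U X →ₗ[ℝ] Ultrapower U Y, IsBoundedMap T → IsAccessible T →
        IsUltraproductOfOperators T,
      approxK X Y < ⊤,
      approxK₀ X Y < ⊤,
      ∀ f : X → Y, IsQuasilinear f → IsTrivialMap f,
      EveryExtensionSplits X Y] := by
  tfae_have 1 → 3 := approxK₀_lt_top_of_forall_isUltraproductOfOperators hU
  tfae_have 3 → 1 := isUltraproductOfOperators_of_approxK₀_lt_top
  tfae_have 3 → 2 := approxK_lt_top_of_approxK₀_lt_top hY hXY
  tfae_have 2 → 3 := approxK₀_le_approxK.trans_lt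
  tfae_have 2 → 4 := fun h f hf => hf.isTrivialMap h
  tfae_have 4 → 2 := approxK_lt_top_of_forall_isTrivialMap hY
  tfae_have 4 → 5 := everyExtensionSplits_of_forall_isTrivialMap
  tfae_have 5 → 4 := fun h f hf => TwistedSum.isTrivialMap h hf
  tfae_finish
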